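/- Assume the Strong Exponential Time Hypothesis (SETH): if, for $q\ge 3$, $\delta_q$ denotes the infimum of the constants $c\ge 0$ for which some algorithm solves $q$-SAT with $n$ variables and $m$ clauses in time $2^{cn}\cdot m^{\mathcal{O}(1)}$, then $\lim_{q\to\infty}\delta_q=1$. A graph is chordal if it has no cycle of length at least $4$ as an induced subgraph, and a chordal vertex deletion set (CVD) of a graph $G$ is a set $S\subseteq V(G)$ such that $G-S$ is chordal. In the problem Vertex Cover By CVD the input is a finite simple graph $G$ and $k,\ell\in\mathbb{N}$, with the promise that $G$ has a CVD of size $k$; the parameter is $k$, and the question is whether $G$ has a vertex cover of size $\ell$. Then for no $\varepsilon>0$ is there an algorithm that solves Vertex Cover By CVD in time $\mathcal{O}^*((2-\varepsilon)^k)$, that is, in time at most $(2-\varepsilon)^k$ times a polynomial in the size of the input. This remains true if a CVD of size $k$ is given as part of the input. Here an algorithm is a deterministic random access machine program and time is its logarithmic cost (each instruction costs one plus the binary lengths of the numbers it handles). -/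

import Mathlib

/-! ## Random access machines with logarithmic cost

A machine has registers, which its program addresses by fixed indices, and an unbounded memory,
which it addresses indirectly through the contents of registers. -/

namespace RAM

/-- The contents of the registers and of the memory cells. -/
structure State where
  reg : ℕ → ℕ
  mem : ℕ → ℕ

/-- The elementary instructions. Subtraction is truncated at `0`, division rounds down. -/
inductive Instr where
  /-- `reg r := c` -/
  | const (r c : ℕ)
  /-- `reg r := reg a` -/
  | copy (r a : ℕ)
  /-- `reg r := reg a + reg b` -/
  | add (r a b : ℕ)
  /-- `reg r := reg a - reg b` -/
  | sub (r a b : ℕ)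
  /-- `reg r := reg a * reg b` -/
  | mul (r a b : ℕ)
  /-- `reg r := reg a / reg b` -/
  | div (r a b : ℕ)
  /-- `reg r := mem (reg a)` -/
  | load (r a : ℕ)
  /-- `mem (reg a) := reg b` -/
  | store (a b : ℕ)

/-- Assign the value `v` to the register `r`. -/
def State.setReg (s : State) (r v : ℕ) : State :=
  { s with reg := Function.update s.reg r v }

/-- Assign the value `v` to the memory cell `a`. -/
def State.setMem (s : State) (a v : ℕ) : State :=
  { s with mem := Function.update s.mem a v }

/-- The effect of an instruction. -/
def Instr.run : Instr → State → State
  | .const r c, s => s.setReg r c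
  | .copy r a, s => s.setReg r (s.reg a)
  | .add r a b, s => s.setReg r (s.reg a + s.reg b)
  | .sub r a b, s => s.setReg r (s.reg a - s.reg b)
  | .mul r a b, s => s.setReg r (s.reg a * s.reg b)
  | .div r a b, s => s.setReg r (s.reg a / s.reg b)
  | .load r a, s => s.setReg r (s.mem (s.reg a))
  | .store a b, s => s.setMem (s.reg a) (s.reg b)

/-- Logarithmic cost of an instruction: one plus the binary lengths of the numbers (operands and
memory addresses) that it handles. -/
def Instr.cost : Instr → State → ℕ
  | .const _ c, _ => 1 + c.size
  | .copy _ a, s => 1 + (s.reg a).size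
  | .add _ a b, s => 1 + (s.reg a).size + (s.reg b).size
  | .sub _ a b, s => 1 + (s.reg a).size + (s.reg b).size
  | .mul _ a b, s => 1 + (s.reg a).size + (s.reg b).size
  | .div _ a b, s => 1 + (s.reg a).size + (s.reg b).size
  | .load _ a, s => 1 + (s.reg a).size + (s.mem (s.reg a)).size
  | .store a b, s => 1 + (s.reg a).size + (s.reg b).size

/-- Programs, with structured control flow in place of jumps (the two are interchangeable up to
a constant factor in the running time). -/
inductive Prog where
  | skip
  | instr (i : Instr)
  | seq (p q : Prog)
  /-- if `reg r ≠ 0` then `p` else `q` -/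
  | ite (r : ℕ) (p q : Prog)
  /-- while `reg r ≠ 0` do `p` -/
  | loop (r : ℕ) (p : Prog)

/-- `Exec p s t s'`: started in the state `s`, the program `p` halts in the state `s'`, and the
whole run costs `t`. A run that does not halt has no `t` and `s'`. -/
inductive Exec : Prog → State → ℕ → State → Prop where
  | skip (s : State) : Exec .skip s 0 s
  | instr (i : Instr) (s : State) : Exec (.instr i) s (i.cost s) (i.run s)
  | seq {p q : Prog} {s s' s'' : State} {t u : ℕ} :
      Exec p s t s' → Exec q s' u s'' → Exec (.seq p q) s (t + u) s''
  | ite_true {r : ℕ} {p : Prog} (q : Prog) {s s' : State} {t : ℕ} :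
      s.reg r ≠ 0 → Exec p s t s' → Exec (.ite r p q) s (1 + (s.reg r).size + t) s'
  | ite_false {r : ℕ} (p : Prog) {q : Prog} {s s' : State} {t : ℕ} :
      s.reg r = 0 → Exec q s t s' → Exec (.ite r p q) s (1 + (s.reg r).size + t) s'
  | loop_done {r : ℕ} (p : Prog) {s : State} :
      s.reg r = 0 → Exec (.loop r p) s (1 + (s.reg r).size) s
  | loop_step {r : ℕ} {p : Prog} {s s' s'' : State} {t u : ℕ} :
      s.reg r ≠ 0 → Exec p s t s' → Exec (.loop r p) s' u s'' →
      Exec (.loop r p) s (1 + (s.reg r).size + t + u) s''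

/-- Runs are deterministic: the initial state determines the cost and the final state. -/
theorem Exec.deterministic {p : Prog} {s s₁ s₂ : State} {t₁ t₂ : ℕ}
    (h₁ : Exec p s t₁ s₁) (h₂ : Exec p s t₂ s₂) : t₁ = t₂ ∧ s₁ = s₂ := by
  induction h₁ generalizing t₂ s₂ with
  | skip s => cases h₂; exact ⟨rfl, rfl⟩
  | instr i s => cases h₂; exact ⟨rfl, rfl⟩
  | seq _ _ ih₁ ih₂ =>
    cases h₂ with
    | seq a b =>
      obtain ⟨rfl, rfl⟩ := ih₁ a
      obtain ⟨rfl, rfl⟩ := ih₂ b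
      exact ⟨rfl, rfl⟩
  | ite_true q hr _ ih =>
    cases h₂ with
    | ite_true _ _ a => obtain ⟨rfl, rfl⟩ := ih a; exact ⟨rfl, rfl⟩
    | ite_false _ hr' _ => exact absurd hr' hr
  | ite_false q hr _ ih =>
    cases h₂ with
    | ite_true _ hr' _ => exact absurd hr hr'
    | ite_false _ _ a => obtain ⟨rfl, rfl⟩ := ih a; exact ⟨rfl, rfl⟩
  | loop_done p hr =>
    cases h₂ with
    | loop_done _ _ => exact ⟨rfl, rfl⟩
    | loop_step hr' _ _ => exact absurd hr hr'
  | loop_step hr _ _ ih₁ ih₂ =>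
    cases h₂ with
    | loop_done _ hr' => exact absurd hr' hr
    | loop_step _ a b =>
      obtain ⟨rfl, rfl⟩ := ih₁ a
      obtain ⟨rfl, rfl⟩ := ih₂ b
      exact ⟨rfl, rfl⟩

/-- The initial state for an input: the input is in the first memory cells, its number of entries
is in register `0`, and everything else is `0`. -/
def input (x : List ℕ) : State where
  reg := fun r => if r = 0 then x.length else 0
  mem := fun i => x.getD i 0

/-- The program `p` solves the decision problem with instances `I`, encoding `enc` and
yes-instances `yes`, and on each instance `x` its running time is at most `T x`. The answer is
"yes" if and only if register `0` finally holds `1`. -/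
def Solves (p : Prog) {I : Type} (enc : I → List ℕ) (yes : I → Prop) (T : I → ℝ) : Prop :=
  ∀ x : I, ∃ (t : ℕ) (s : State),
    Exec p (input (enc x)) t s ∧ (t : ℝ) ≤ T x ∧ (s.reg 0 = 1 ↔ yes x)

/-- The size of an input: the total binary length of its entries, plus one for each entry. -/
def inputSize (x : List ℕ) : ℕ := (x.map fun a => a.size + 1).sum

end RAM

/-! ## `q`-SAT and the Strong Exponential Time Hypothesis -/

/-- Instances of `q`-SAT: a number `n` of variables and a list of clauses, each of them a list of
at most `q` literals. The literal `(v, b)` is satisfied if the variable `v` has the value `b`. -/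
structure QSAT (q : ℕ) where
  n : ℕ
  clauses : List (List (Fin n × Bool))
  length_le : ∀ c ∈ clauses, c.length ≤ q

namespace QSAT

variable {q : ℕ}

/-- The formula has a satisfying assignment. -/
def Satisfiable (φ : QSAT q) : Prop :=
  ∃ a : Fin φ.n → Bool, ∀ c ∈ φ.clauses, ∃ l ∈ c, a l.1 = l.2

/-- The input that stands for a formula: the number of variables, the number of clauses, and each
clause as its length followed by its literals. -/
def encode (φ : QSAT q) : List ℕ :=
  φ.n :: φ.clauses.length ::
    φ.clauses.flatMap fun c => c.length :: c.map fun l => 2 * l.1.val + l.2.toNat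

end QSAT

/-- Some algorithm solves `q`-SAT with `n` variables and `m` clauses in time
`2 ^ (c * n) * m ^ O(1)`. -/
def QSATSolvable (q : ℕ) (c : ℝ) : Prop :=
  ∃ (p : RAM.Prog) (C d : ℕ), RAM.Solves p (QSAT.encode (q := q)) QSAT.Satisfiable
    fun φ => C * (2 : ℝ) ^ (c * (φ.n : ℝ)) * ((φ.clauses.length : ℝ) + 1) ^ d

/-- The infimum `δ_q` of the exponents with which `q`-SAT can be solved. -/
noncomputable def satExponent (q : ℕ) : ℝ := sInf {c : ℝ | 0 ≤ c ∧ QSATSolvable q c}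

/-- The Strong Exponential Time Hypothesis: `δ_q` tends to `1` as `q` tends to infinity. -/
def SETH : Prop := Filter.Tendsto satExponent Filter.atTop (nhds 1)

/-! ## Vertex Cover parameterized by the size of a chordal vertex deletion set -/

/-- A graph is chordal if no cycle of length at least `4` is an induced subgraph of it. -/
def IsChordal {V : Type} (G : SimpleGraph V) : Prop :=
  ∀ m : ℕ, 4 ≤ m → ¬ (SimpleGraph.cycleGraph m).IsIndContained G

/-- `S` is a chordal vertex deletion set of `G`: the graph `G - S` is chordal. -/
def IsCVD {V : Type} (G : SimpleGraph V) (S : Set V) : Prop :=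
  IsChordal (G.induce Sᶜ)

/-- Instances of Vertex Cover By CVD: a graph `G` on `n` vertices and numbers `k` and `ℓ`, with
the promise that `G` has a chordal vertex deletion set of size `k`. -/
structure VCByCVD where
  n : ℕ
  G : SimpleGraph (Fin n)
  k : ℕ
  ℓ : ℕ
  promise : ∃ S : Finset (Fin n), S.card = k ∧ IsCVD G (S : Set (Fin n))

/-- The variant in which a chordal vertex deletion set `S` of size `k` is part of the input. -/
structure VCByGivenCVD where
  n : ℕ
  G : SimpleGraph (Fin n)
  k : ℕ
  ℓ : ℕ
  S : Finset (Fin n)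
  card_S : S.card = k
  isCVD_S : IsCVD G (S : Set (Fin n))

/-- `G` has a vertex cover of size `ℓ`. -/
def HasVertexCover {n : ℕ} (G : SimpleGraph (Fin n)) (ℓ : ℕ) : Prop :=
  ∃ C : Finset (Fin n), C.card = ℓ ∧ G.IsVertexCover (C : Set (Fin n))

open Classical in
/-- The input that stands for `(G, k, ℓ)`: the number of vertices, `k`, `ℓ`, and the rows of the
adjacency matrix. -/
noncomputable def encodeGraph {n : ℕ} (G : SimpleGraph (Fin n)) (k ℓ : ℕ) : List ℕ :=
  n :: k :: ℓ ::
    (List.finRange n).flatMap fun i => (List.finRange n).map fun j => if G.Adj i j then 1 else 0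

/-- The input that stands for an instance of Vertex Cover By CVD. -/
noncomputable def VCByCVD.encode (x : VCByCVD) : List ℕ := encodeGraph x.G x.k x.ℓ

/-- The input that stands for an instance with a given set `S`, which is represented by its
characteristic vector. -/
noncomputable def VCByGivenCVD.encode (x : VCByGivenCVD) : List ℕ :=
  encodeGraph x.G x.k x.ℓ ++ (List.finRange x.n).map fun i => if i ∈ x.S then 1 else 0

/-- Vertex Cover By CVD can be solved in time `O*(b ^ k)`, that is, in time `b ^ k` times a
polynomial in the size of the input. -/
def VCByCVDSolvable (b : ℝ) : Prop :=
  ∃ (p : RAM.Prog) (C d : ℕ), RAM.Solves p VCByCVD.encode (fun x => HasVertexCover x.G x.ℓ)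
    fun x => C * b ^ x.k * (RAM.inputSize x.encode : ℝ) ^ d

/-- Vertex Cover By CVD with a given chordal vertex deletion set can be solved in time
`O*(b ^ k)`. -/
def VCByGivenCVDSolvable (b : ℝ) : Prop :=
  ∃ (p : RAM.Prog) (C d : ℕ), RAM.Solves p VCByGivenCVD.encode (fun x => HasVertexCover x.G x.ℓ)
    fun x => C * b ^ x.k * (RAM.inputSize x.encode : ℝ) ^ d

/-!
Suppose that Vertex Cover By CVD can be solved in time `O*(b ^ k)` with `b < 2`. For a constant
`c < 1` that does not depend on `q`, every `q`-SAT problem is then solved in time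
`2 ^ (c * n) * m ^ O(1)`, so that all exponents `δ_q` are at most `c`, contrary to SETH.

The reduction goes through hitting sets. The variables are split into blocks of constant size `β`,
and each block gets `γ` elements, where `γ / β` is close to `1`. An assignment of a block is encoded
by a set of `h = γ / 2` elements (`BlockCode`); there are enough of them by the bound for
the central binomial coefficient (`exists_block_sizes`). Since sets of equal size form an antichain,
a union of codes is singled out by monotone conditions together with its size: a set of at most
`h` times the number of blocks elements that meets every set which meets all codes of a block is
a union of codes. Likewise, if the complements of some codes are missed, then exactly these codes are
present; so a clause is expressed by requiring that the sets which, when missed, determine an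
assignment that violates the clause, be hit (`BlockCode.Required`). All these sets are spread over
at most `q` blocks, so there are only polynomially many of them.

Sets to be hit become cliques, one vertex of which may stay out of a vertex cover if the element
that it stands for is in the cover (`hittingGraph`). The deletion of the elements leaves a disjoint
union of cliques, which is chordal (`isChordal_of_trans`), so the parameter `k` is the number of
elements, about `n * γ / β`, and `b ^ k` is at most a constant times `2 ^ (c₁ * n)` with `c₁ < 1`.
The polynomial factors in `n` are absorbed by a slightly larger exponent (`qsatSolvable_of_graph`).

The reduction is carried out by a random access machine as follows. Each entry of the encoding of
the graph is the value of an arithmetic expression in its position, with bounded recursion over the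
encoding of the formula (`RAM.Expr`). All such expressions are evaluated by
programs in polynomial time (`RAM.Expr.exists_evaluates`). The new list is written behind the
input, and the given program is run on it with all addresses shifted
(`RAM.exists_reduction`, `RAM.Exec.shift`). Anything that depends on `β`, `γ` and the code only is
hard-wired as a table (`RAM.Expr.table`).
-/

namespace RAM

/-! ### Polynomially bounded functions -/

/-- A monotone function that is bounded by a power of its argument from `2` on. -/
def PolyBdd (F : ℕ → ℕ) : Prop := Monotone F ∧ ∃ d, ∀ X, 2 ≤ X → F X ≤ X ^ d

namespace PolyBdd

theorem id : PolyBdd fun X => X := ⟨monotone_id, 1, fun X _ => by simp⟩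

theorem const (c : ℕ) : PolyBdd fun _ => c :=
  ⟨monotone_const, c, fun _ hX => (Nat.lt_two_pow_self).le.trans (Nat.pow_le_pow_left hX c)⟩

theorem add {F G : ℕ → ℕ} (hF : PolyBdd F) (hG : PolyBdd G) : PolyBdd fun X => F X + G X := by
  obtain ⟨mF, d, hd⟩ := hF
  obtain ⟨mG, e, he⟩ := hG
  refine ⟨mF.add mG, d + e + 1, fun X hX => ?_⟩
  have h1 : X ^ d ≤ X ^ (d + e) := Nat.pow_le_pow_right (by omega) (by omega)
  have h2 : X ^ e ≤ X ^ (d + e) := Nat.pow_le_pow_right (by omega) (by omega)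
  have h3 : X ^ (d + e) * 2 ≤ X ^ (d + e + 1) := by
    rw [pow_succ]; exact Nat.mul_le_mul_left _ hX
  have := hd X hX
  have := he X hX
  simp only
  omega

theorem mul {F G : ℕ → ℕ} (hF : PolyBdd F) (hG : PolyBdd G) : PolyBdd fun X => F X * G X := by
  obtain ⟨mF, d, hd⟩ := hF
  obtain ⟨mG, e, he⟩ := hG
  refine ⟨fun X Y h => Nat.mul_le_mul (mF h) (mG h), d + e, fun X hX => ?_⟩
  rw [pow_add]
  exact Nat.mul_le_mul (hd X hX) (he X hX)

theorem comp {F G : ℕ → ℕ} (hF : PolyBdd F) (hG : PolyBdd G) : PolyBdd fun X => F (G X) := by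
  obtain ⟨e, he⟩ := (id.add hG).2
  obtain ⟨mF, d, hd⟩ := hF
  refine ⟨fun X Y h => mF (hG.1 h), e * d, fun X hX => ?_⟩
  calc F (G X) ≤ F (X + G X) := mF (by omega)
    _ ≤ (X + G X) ^ d := hd _ (by omega)
    _ ≤ (X ^ e) ^ d := Nat.pow_le_pow_left (he X hX) d
    _ = X ^ (e * d) := (pow_mul _ _ _).symm

theorem pow {F : ℕ → ℕ} (hF : PolyBdd F) (d : ℕ) : PolyBdd fun X => F X ^ d := by
  induction d with
  | zero => simpa using const 1
  | succ d ih => simpa only [pow_succ] using ih.mul hF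

end PolyBdd

/-! ### Runs within a time bound -/

theorem size_le_self (n : ℕ) : n.size ≤ n := Nat.size_le.2 Nat.lt_two_pow_self

/-- Started in the state `s`, the program `p` halts in the state `s'` at cost at most `T`. -/
def Runs (p : Prog) (s : State) (T : ℕ) (s' : State) : Prop := ∃ t ≤ T, Exec p s t s'

namespace Runs

theorem seq {p q : Prog} {s s' s'' : State} {T U : ℕ} (hp : Runs p s T s') (hq : Runs q s' U s'') :
    Runs (.seq p q) s (T + U) s'' := by
  obtain ⟨t, ht, h⟩ := hp
  obtain ⟨u, hu, h'⟩ := hq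
  exact ⟨t + u, by omega, .seq h h'⟩

theorem instr {i : Instr} {s : State} {T : ℕ} (h : i.cost s ≤ T) :
    Runs (.instr i) s T (i.run s) := ⟨_, h, .instr i s⟩

theorem mono {p : Prog} {s s' : State} {T U : ℕ} (hp : Runs p s T s') (h : T ≤ U) :
    Runs p s U s' := by
  obtain ⟨t, ht, h'⟩ := hp
  exact ⟨t, ht.trans h, h'⟩

/-- A counting loop: the register `r` counts down from `n` to `0`, and the invariant `I` is indexed
by the number of completed rounds. -/
theorem loop {r : ℕ} {p : Prog} {n T : ℕ} {I : ℕ → State → Prop}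
    (hI : ∀ i s, I i s → s.reg r = n - i)
    (hstep : ∀ i s, i < n → I i s → ∃ s', Runs p s T s' ∧ I (i + 1) s')
    {s : State} (hs : I 0 s) :
    ∃ s', Runs (.loop r p) s (n * (1 + n + T) + 1) s' ∧ I n s' := by
  suffices H : ∀ j i s, i + j = n → I i s →
      ∃ s', Runs (.loop r p) s (j * (1 + n + T) + 1) s' ∧ I n s' from H n 0 s (by omega) hs
  intro j
  induction j with
  | zero =>
    intro i s hi h
    have hr : s.reg r = 0 := by rw [hI i s h]; omega
    refine ⟨s, ⟨_, ?_, .loop_done p hr⟩, by rwa [← hi]⟩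
    simp [hr]
  | succ j ih =>
    intro i s hi h
    obtain ⟨s₁, ⟨t, ht, e⟩, h₁⟩ := hstep i s (by omega) h
    obtain ⟨s₂, ⟨u, hu, e'⟩, h₂⟩ := ih (i + 1) s₁ (by omega) h₁
    have hr := hI i s h
    refine ⟨s₂, ⟨_, ?_, .loop_step (by omega) e e'⟩, h₂⟩
    have := size_le_self (s.reg r)
    have h4 : s.reg r ≤ n := by omega
    rw [add_mul]
    omega

end Runs

/-! ### Arithmetic expressions and their compilation -/

/-- The environment `f` with a new variable of value `a` in front. -/
def push (a : ℕ) (f : ℕ → ℕ) : ℕ → ℕ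
  | 0 => a
  | i + 1 => f i

@[simp] theorem push_zero (a : ℕ) (f : ℕ → ℕ) : push a f 0 = a := rfl
@[simp] theorem push_succ (a : ℕ) (f : ℕ → ℕ) (i : ℕ) : push a f (i + 1) = f i := rfl
@[simp] theorem push_one (a : ℕ) (f : ℕ → ℕ) : push a f 1 = f 0 := rfl

/-- Recursion with values cut off at `cap`: starting from `0`, the function `f` is applied to the
index of the round and the previous value. -/
def cappedRec (cap : ℕ) (f : ℕ → ℕ → ℕ) : ℕ → ℕ
  | 0 => 0
  | i + 1 => min (f i (cappedRec cap f i)) cap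

theorem cappedRec_le (cap : ℕ) (f : ℕ → ℕ → ℕ) (n : ℕ) : cappedRec cap f n ≤ cap := by
  cases n <;> simp [cappedRec]

/-- Arithmetic expressions over a list of numbers and an environment, with variables as de Bruijn
indices. The only recursion has an explicit bound on the number of rounds and on the values, which
keeps every expression polynomially bounded. -/
inductive Expr where
  | var (i : ℕ)
  | const (c : ℕ)
  | add (a b : Expr)
  | sub (a b : Expr)
  | mul (a b : Expr)
  | div (a b : Expr)
  /-- the entry of the list at a given position -/
  | load (a : Expr)
  /-- `b` with the value of `a` as variable `0` -/
  | bind (a b : Expr)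
  /-- `n` rounds of `body`, in which variable `0` is the index of the round and variable `1` the
  previous value, with values cut off at `cap` -/
  | iter (n cap body : Expr)

namespace Expr

/-- The value of an expression. -/
def eval (x : List ℕ) : Expr → (ℕ → ℕ) → ℕ
  | var i, env => env i
  | const c, _ => c
  | add a b, env => a.eval x env + b.eval x env
  | sub a b, env => a.eval x env - b.eval x env
  | mul a b, env => a.eval x env * b.eval x env
  | div a b, env => a.eval x env / b.eval x env
  | load a, env => x.getD (a.eval x env) 0
  | bind a b, env => b.eval x (push (a.eval x env) env)
  | iter n cap body, env =>
      cappedRec (cap.eval x env) (fun i acc => body.eval x (push i (push acc env))) (n.eval x env)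

/-- A program that evaluates an expression into the register `k`, with the registers from `k` on as
its work space. The variable `i` is kept in the register `ρ i`, and the register `z` holds the
length of the list. -/
def compile (z : ℕ) : Expr → (ℕ → ℕ) → ℕ → Prog
  | var i, ρ, k => .instr (.copy k (ρ i))
  | const c, _, k => .instr (.const k c)
  | add a b, ρ, k =>
      .seq (a.compile z ρ k) (.seq (b.compile z ρ (k + 1)) (.instr (.add k k (k + 1))))
  | sub a b, ρ, k =>
      .seq (a.compile z ρ k) (.seq (b.compile z ρ (k + 1)) (.instr (.sub k k (k + 1))))
  | mul a b, ρ, k =>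
      .seq (a.compile z ρ k) (.seq (b.compile z ρ (k + 1)) (.instr (.mul k k (k + 1))))
  | div a b, ρ, k =>
      .seq (a.compile z ρ k) (.seq (b.compile z ρ (k + 1)) (.instr (.div k k (k + 1))))
  -- the address is cut off at the length of the list, where the memory holds `0`
  | load a, ρ, k =>
      .seq (a.compile z ρ k) (.seq (.instr (.sub (k + 1) k z))
        (.seq (.instr (.sub k k (k + 1))) (.instr (.load k k))))
  | bind a b, ρ, k =>
      .seq (a.compile z ρ k) (.seq (b.compile z (push k ρ) (k + 1)) (.instr (.copy k (k + 1))))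
  | iter n cap body, ρ, k =>
      .seq (n.compile z ρ k) (.seq (cap.compile z ρ (k + 1)) (.seq (.instr (.const (k + 2) 0))
        (.seq (.instr (.const (k + 3) 0)) (.seq
          (.loop k (.seq (body.compile z (push (k + 3) (push (k + 2) ρ)) (k + 4))
            (.seq (.instr (.sub (k + 5) (k + 4) (k + 1)))
            (.seq (.instr (.sub (k + 2) (k + 4) (k + 5)))
            (.seq (.instr (.const (k + 5) 1))
            (.seq (.instr (.add (k + 3) (k + 3) (k + 5)))
              (.instr (.sub k k (k + 5)))))))))
          (.instr (.copy k (k + 2)))))))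

/-- The state `s` is prepared for the evaluation of expressions at level `k`: the list `x` is in
memory, followed by a `0`, its length is in the register `z`, the environment is in the registers
given by `ρ`, and all these numbers are at most `X`. -/
structure Ready (X : ℕ) (x : List ℕ) (z : ℕ) (ρ : ℕ → ℕ) (k : ℕ) (env : ℕ → ℕ) (s : State) :
    Prop where
  two_le : 2 ≤ X
  length_le : x.length ≤ X
  le : ∀ a ∈ x, a ≤ X
  z_lt : z < k
  reg_z : s.reg z = x.length
  mem : ∀ a ≤ x.length, s.mem a = x.getD a 0
  ρ_lt : ∀ i, ρ i < k
  reg_ρ : ∀ i, s.reg (ρ i) = env i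
  env_le : ∀ i, env i ≤ X

theorem Ready.mono {X : ℕ} {x : List ℕ} {z : ℕ} {ρ : ℕ → ℕ} {k k' : ℕ} {env : ℕ → ℕ}
    {s s' : State} (h : Ready X x z ρ k env s) (hk : k ≤ k') (hr : ∀ r < k, s'.reg r = s.reg r)
    (hm : s'.mem = s.mem) : Ready X x z ρ k' env s' where
  two_le := h.two_le
  length_le := h.length_le
  le := h.le
  z_lt := h.z_lt.trans_le hk
  reg_z := by rw [hr _ h.z_lt, h.reg_z]
  mem := by rw [hm]; exact h.mem
  ρ_lt := fun i => (h.ρ_lt i).trans_le hk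
  reg_ρ := fun i => by rw [hr _ (h.ρ_lt i), h.reg_ρ]
  env_le := h.env_le

theorem Ready.weaken {X Y : ℕ} {x : List ℕ} {z : ℕ} {ρ : ℕ → ℕ} {k : ℕ} {env : ℕ → ℕ}
    {s : State} (h : Ready X x z ρ k env s) (hY : X ≤ Y) : Ready Y x z ρ k env s :=
  { h with
    two_le := h.two_le.trans hY
    length_le := h.length_le.trans hY
    le := fun a ha => (h.le a ha).trans hY
    env_le := fun i => (h.env_le i).trans hY }

theorem Ready.push {X : ℕ} {x : List ℕ} {z : ℕ} {ρ : ℕ → ℕ} {k : ℕ} {env : ℕ → ℕ} {s : State}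
    (h : Ready X x z ρ k env s) {r : ℕ} (hr : r < k) {v : ℕ} (hv : v ≤ X) (hrv : s.reg r = v) :
    Ready X x z (push r ρ) k (push v env) s :=
  { h with
    ρ_lt := fun i => by cases i <;> simp [hr, h.ρ_lt]
    reg_ρ := fun i => by cases i <;> simp [hrv, h.reg_ρ]
    env_le := fun i => by cases i <;> simp [hv, h.env_le] }

/-- The expression `e` has value at most `F X` and is evaluated correctly at cost at most `F X`,
where `X` bounds the input. -/
def Evaluates (e : Expr) (F : ℕ → ℕ) : Prop :=
  ∀ X x z ρ k env s, Ready X x z ρ k env s → e.eval x env ≤ F X ∧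
    ∃ s', Runs (e.compile z ρ k) s (F X) s' ∧ s'.reg k = e.eval x env ∧
      (∀ r < k, s'.reg r = s.reg r) ∧ s'.mem = s.mem

/-- Two operands are evaluated into the registers `k` and `k + 1`. -/
theorem Evaluates.pair {a b : Expr} {F G : ℕ → ℕ} (ha : a.Evaluates F) (hb : b.Evaluates G)
    {X : ℕ} {x : List ℕ} {z : ℕ} {ρ : ℕ → ℕ} {k : ℕ} {env : ℕ → ℕ} {s : State}
    (h : Ready X x z ρ k env s) :
    ∃ s₁ s₂, Runs (a.compile z ρ k) s (F X) s₁ ∧ Runs (b.compile z ρ (k + 1)) s₁ (G X) s₂ ∧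
      s₂.reg k = a.eval x env ∧ s₂.reg (k + 1) = b.eval x env ∧ (∀ r < k, s₂.reg r = s.reg r) ∧
      s₂.mem = s.mem := by
  obtain ⟨_, s₁, e₁, v₁, r₁, m₁⟩ := ha _ _ _ _ _ _ _ h
  obtain ⟨_, s₂, e₂, v₂, r₂, m₂⟩ := hb _ _ _ _ _ _ _ (h.mono (Nat.le_succ k) r₁ m₁)
  exact ⟨s₁, s₂, e₁, e₂, by rw [r₂ _ (by omega), v₁], v₂,
    fun r hr => by rw [r₂ _ (by omega), r₁ _ hr], by rw [m₂, m₁]⟩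

/-- The binary operations, given as an instruction `i` with the value `op`. -/
theorem Evaluates.binary {a b e : Expr} {F G : ℕ → ℕ} (ha : a.Evaluates F) (hb : b.Evaluates G)
    (i : ℕ → Instr) (op : ℕ → ℕ → ℕ)
    (hcost : ∀ k s, (i k).cost s = 1 + (s.reg k).size + (s.reg (k + 1)).size)
    (hrun : ∀ k s, (i k).run s = s.setReg k (op (s.reg k) (s.reg (k + 1))))
    (hop : ∀ u v, op u v ≤ u + v + u * v)
    (heval : ∀ x env, e.eval x env = op (a.eval x env) (b.eval x env))
    (hcomp : ∀ z ρ k, e.compile z ρ k =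
      .seq (a.compile z ρ k) (.seq (b.compile z ρ (k + 1)) (.instr (i k)))) :
    e.Evaluates fun X => F X + (G X + (1 + F X + G X + F X * G X)) := by
  intro X x z ρ k env s h
  beta_reduce
  obtain ⟨s₁, s₂, e₁, e₂, va, vb, hr, hm⟩ := ha.pair hb h
  have la := (ha _ _ _ _ _ _ _ h).1
  have lb := (hb _ _ _ _ _ _ _ (h.mono (Nat.le_succ k) (fun _ _ => rfl) rfl)).1
  have lm := Nat.mul_le_mul la lb
  rw [heval, hcomp]
  refine ⟨(hop _ _).trans (by omega), _, e₁.seq (e₂.seq (.instr ?_)), ?_, ?_, ?_⟩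
  · rw [hcost, va, vb]
    have := size_le_self (a.eval x env)
    have := size_le_self (b.eval x env)
    omega
  · simp [hrun, State.setReg, va, vb]
  · intro r hr'
    rw [hrun, ← hr r hr']
    simp [State.setReg, Function.update_of_ne hr'.ne]
  · rw [hrun, ← hm]; rfl

theorem Evaluates.load {a : Expr} {F : ℕ → ℕ} (ha : a.Evaluates F) :
    (Expr.load a).Evaluates fun X => F X + (1 + F X + X + (1 + F X + F X + (1 + F X + X))) := by
  intro X x z ρ k env s h
  beta_reduce
  obtain ⟨la, s₁, e₁, v₁, r₁, m₁⟩ := ha _ _ _ _ _ _ _ h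
  have hx : ∀ i, x.getD i 0 ≤ X := fun i => by
    by_cases hi : i < x.length
    · rw [List.getD_eq_getElem _ _ hi]; exact h.le _ (List.getElem_mem hi)
    · rw [List.getD_eq_default _ _ (by omega)]; omega
  have hz : s₁.reg z = x.length := by rw [r₁ _ h.z_lt, h.reg_z]
  have hzk : z ≠ k := h.z_lt.ne
  have hmin : a.eval x env - (a.eval x env - x.length) = min (a.eval x env) x.length := by omega
  have hload : s₁.mem (min (a.eval x env) x.length) = x.getD (a.eval x env) 0 := by
    rw [m₁, h.mem _ (min_le_right _ _)]
    rcases le_total (a.eval x env) x.length with h' | h'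
    · rw [min_eq_left h']
    · rw [min_eq_right h', List.getD_eq_default _ _ h', List.getD_eq_default _ _ le_rfl]
  have hlen := h.length_le
  refine ⟨(hx _).trans (by omega), _, e₁.seq (.seq (.instr ?_) (.seq (.instr ?_) (.instr ?_))),
    ?_, ?_, ?_⟩
  · simp only [Instr.cost, v₁, hz]
    have := size_le_self (a.eval x env)
    have := size_le_self x.length
    omega
  · simp [Instr.cost, Instr.run, State.setReg, v₁, hz]
    have := size_le_self (a.eval x env)
    have := size_le_self (a.eval x env - x.length)
    omega
  · simp [Instr.cost, Instr.run, State.setReg, v₁, hz, hmin, hload]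
    have := size_le_self (min (a.eval x env) x.length)
    have := size_le_self (x.getD (a.eval x env) 0)
    have := hx (a.eval x env)
    simp only [List.getD_eq_getElem?_getD] at *
    omega
  · simp [Instr.run, State.setReg, v₁, hz, hmin, hload, Expr.eval]
  · intro r hr
    rw [← r₁ r hr]
    simp [Instr.run, State.setReg, Function.update_of_ne hr.ne,
      Function.update_of_ne (show r ≠ k + 1 by omega)]
  · rw [← m₁]; rfl

theorem Evaluates.bind {a b : Expr} {F G : ℕ → ℕ} (ha : a.Evaluates F)
    (hb : b.Evaluates G) :
    (Expr.bind a b).Evaluates fun X => F X + (G (X + F X) + (1 + G (X + F X))) := by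
  intro X x z ρ k env s h
  beta_reduce
  obtain ⟨la, s₁, e₁, v₁, r₁, m₁⟩ := ha _ _ _ _ _ _ _ h
  obtain ⟨lb, s₂, e₂, v₂, r₂, m₂⟩ := hb _ _ _ _ _ _ _
    (((h.mono (Nat.le_succ k) r₁ m₁).weaken (Nat.le_add_right X (F X))).push (Nat.lt_succ_self k)
      (la.trans (Nat.le_add_left _ _)) v₁)
  simp only [eval]
  refine ⟨by omega, _, e₁.seq (e₂.seq (.instr ?_)), ?_, ?_, ?_⟩
  · simp only [Instr.cost, v₂]
    have := size_le_self (b.eval x (RAM.push (a.eval x env) env))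
    omega
  · simp [Instr.run, State.setReg, v₂]
  · intro r hr
    rw [← r₁ r hr, ← r₂ r (by omega)]
    simp [Instr.run, State.setReg, Function.update_of_ne hr.ne]
  · rw [← m₁, ← m₂]; rfl

theorem Evaluates.iter {n cap body : Expr} {F G H : ℕ → ℕ} (hn : n.Evaluates F)
    (hcap : cap.Evaluates G) (hbody : body.Evaluates H) :
    (Expr.iter n cap body).Evaluates fun X => F X + (G X + (1 + (1 +
      (F X * (1 + F X + (H (X + F X + G X) + (1 + H (X + F X + G X) + G X +
        (1 + H (X + F X + G X) + H (X + F X + G X) + (2 + (2 + F X + (2 + F X))))))) + 1 +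
        (1 + G X))))) := by
  intro X x z ρ k env s h
  beta_reduce
  set Y := X + F X + G X with hY
  obtain ⟨s₁, s₂, e₁, e₂, va, vb, hr, hm⟩ := hn.pair hcap h
  have ln := (hn _ _ _ _ _ _ _ h).1
  have lc := (hcap _ _ _ _ _ _ _ (h.mono (Nat.le_succ k) (fun _ _ => rfl) rfl)).1
  set N := n.eval x env with hN
  set C := cap.eval x env with hC
  set f : ℕ → ℕ → ℕ := fun i acc => body.eval x (RAM.push i (RAM.push acc env)) with hf
  -- the invariant after `i` rounds
  let I : ℕ → State → Prop := fun i t => t.reg k = N - i ∧ t.reg (k + 1) = C ∧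
    t.reg (k + 2) = cappedRec C f i ∧ t.reg (k + 3) = i ∧ (∀ r < k, t.reg r = s.reg r) ∧
    t.mem = s.mem
  let s₄ : State := (Instr.const (k + 3) 0).run ((Instr.const (k + 2) 0).run s₂)
  have hI0 : I 0 s₄ := by
    refine ⟨?_, ?_, ?_, ?_, ?_, ?_⟩
    · simp [s₄, Instr.run, State.setReg, va]
    · simp [s₄, Instr.run, State.setReg, vb]
    · simp [s₄, Instr.run, State.setReg, cappedRec]
    · simp [s₄, Instr.run, State.setReg]
    · intro r hr'
      rw [← hr r hr']
      simp [s₄, Instr.run, State.setReg, Function.update_of_ne (show r ≠ k + 2 by omega),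
        Function.update_of_ne (show r ≠ k + 3 by omega)]
    · rw [← hm]; rfl
  have hC' : ∀ i, cappedRec C f i ≤ Y := fun i => (cappedRec_le _ _ _).trans (by omega)
  obtain ⟨s₅, e₅, h₅⟩ := Runs.loop (r := k) (n := N) (I := I)
    (T := H Y + (1 + H Y + G X + (1 + H Y + H Y + (2 + (2 + F X + (2 + F X))))))
    (p := .seq (body.compile z (RAM.push (k + 3) (RAM.push (k + 2) ρ)) (k + 4))
            (.seq (.instr (.sub (k + 5) (k + 4) (k + 1)))
            (.seq (.instr (.sub (k + 2) (k + 4) (k + 5)))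
            (.seq (.instr (.const (k + 5) 1))
            (.seq (.instr (.add (k + 3) (k + 3) (k + 5)))
              (.instr (.sub k k (k + 5)))))))) (fun i t ht => ht.1) (by
      rintro i t hi ⟨t0, t1, t2, t3, tr, tm⟩
      obtain ⟨lf, u, eu, vu, ru, mu⟩ := hbody Y x z _ (k + 4) _ t
        ((((h.mono (Nat.le_add_right k 4) tr tm).weaken (Y := Y) (by omega)).push
          (show k + 2 < k + 4 by omega) (hC' i) t2).push (show k + 3 < k + 4 by omega)
          (show i ≤ Y by omega) t3)
      change u.reg (k + 4) = f i (cappedRec C f i) at vu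
      change f i (cappedRec C f i) ≤ H Y at lf
      have u0 : u.reg k = N - i := by rw [ru _ (by omega), t0]
      have u1 : u.reg (k + 1) = C := by rw [ru _ (by omega), t1]
      have u3 : u.reg (k + 3) = i := by rw [ru _ (by omega), t3]
      set v := f i (cappedRec C f i) with hv
      have hmin : v - (v - C) = min v C := by omega
      refine ⟨_, eu.seq (.seq (.instr ?_) (.seq (.instr ?_) (.seq (.instr ?_) (.seq (.instr ?_)
        (.instr ?_))))), ?_, ?_, ?_, ?_, ?_, ?_⟩
      · simp only [Instr.cost, vu, u1]
        have := size_le_self v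
        have := size_le_self C
        omega
      · simp [Instr.cost, Instr.run, State.setReg, vu, u1]
        have := size_le_self v
        have := size_le_self (v - C)
        omega
      · simp [Instr.cost]
      · simp [Instr.cost, Instr.run, State.setReg, u3]
        have := size_le_self i
        omega
      · simp [Instr.cost, Instr.run, State.setReg, u0]
        have := size_le_self (N - i)
        omega
      · simp [Instr.run, State.setReg, u0]; omega
      · simp [Instr.run, State.setReg, u1]
      · simp [Instr.run, State.setReg, vu, u1, hmin, cappedRec, ← hv]
      · simp [Instr.run, State.setReg, u3]
      · intro r hr'
        rw [← tr r hr', ← ru r (by omega)]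
        simp [Instr.run, State.setReg, Function.update_of_ne (show r ≠ k + 2 by omega),
          Function.update_of_ne (show r ≠ k + 3 by omega),
          Function.update_of_ne (show r ≠ k + 5 by omega), Function.update_of_ne hr'.ne]
      · rw [← tm, ← mu]; rfl) hI0
  obtain ⟨-, -, w2, -, wr, wm⟩ := h₅
  have hval : (Expr.iter n cap body).eval x env = cappedRec C f N := rfl
  have hle : cappedRec C f N ≤ G X := (cappedRec_le _ _ _).trans lc
  rw [hval]
  refine ⟨by omega, _, e₁.seq (e₂.seq (.seq (.instr (by simp [Instr.cost])) (.seq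
    (.instr (by simp [Instr.cost])) (Runs.seq (e₅.mono ?_) (.instr ?_))))), ?_, ?_, ?_⟩
  · gcongr
  · simp only [Instr.cost, w2]
    have := size_le_self (cappedRec C f N)
    omega
  · simp [Instr.run, State.setReg, w2]
  · intro r hr'
    rw [← wr r hr']
    simp [Instr.run, State.setReg, Function.update_of_ne hr'.ne]
  · rw [← wm]; rfl

/-- Every expression is evaluated by its program in polynomial time. -/
theorem exists_evaluates (e : Expr) : ∃ F, PolyBdd F ∧ e.Evaluates F := by
  have one := PolyBdd.const 1
  have two := PolyBdd.const 2
  have X := PolyBdd.id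
  induction e with
  | var i =>
    refine ⟨_, one.add X, fun X x z ρ k env s h => ⟨(h.env_le i).trans (by omega), _, .instr ?_,
      ?_, ?_, rfl⟩⟩
    · simp only [Instr.cost, h.reg_ρ]
      have := size_le_self (env i)
      have := h.env_le i
      omega
    · simp [Instr.run, State.setReg, h.reg_ρ, eval]
    · intro r hr
      simp [Instr.run, State.setReg, Function.update_of_ne hr.ne]
  | const c =>
    refine ⟨_, one.add (.const c), fun X x z ρ k env s h => ⟨by simp [eval], _, .instr ?_,
      ?_, ?_, rfl⟩⟩
    · simp only [Instr.cost]
      have := size_le_self c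
      omega
    · simp [Instr.run, State.setReg, eval]
    · intro r hr
      simp [Instr.run, State.setReg, Function.update_of_ne hr.ne]
  | add a b iha ihb =>
    obtain ⟨F, pF, hF⟩ := iha
    obtain ⟨G, pG, hG⟩ := ihb
    exact ⟨_, pF.add (pG.add (((one.add pF).add pG).add (pF.mul pG))),
      hF.binary hG (fun k => .add k k (k + 1)) (· + ·) (fun _ _ => rfl) (fun _ _ => rfl)
        (fun u v => Nat.le_add_right _ _) (fun _ _ => rfl) fun _ _ _ => rfl⟩
  | sub a b iha ihb =>
    obtain ⟨F, pF, hF⟩ := iha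
    obtain ⟨G, pG, hG⟩ := ihb
    exact ⟨_, pF.add (pG.add (((one.add pF).add pG).add (pF.mul pG))),
      hF.binary hG (fun k => .sub k k (k + 1)) (· - ·) (fun _ _ => rfl) (fun _ _ => rfl)
        (fun u v => (Nat.sub_le u v).trans (by omega)) (fun _ _ => rfl) fun _ _ _ => rfl⟩
  | mul a b iha ihb =>
    obtain ⟨F, pF, hF⟩ := iha
    obtain ⟨G, pG, hG⟩ := ihb
    exact ⟨_, pF.add (pG.add (((one.add pF).add pG).add (pF.mul pG))),
      hF.binary hG (fun k => .mul k k (k + 1)) (· * ·) (fun _ _ => rfl) (fun _ _ => rfl)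
        (fun u v => Nat.le_add_left _ _) (fun _ _ => rfl) fun _ _ _ => rfl⟩
  | div a b iha ihb =>
    obtain ⟨F, pF, hF⟩ := iha
    obtain ⟨G, pG, hG⟩ := ihb
    exact ⟨_, pF.add (pG.add (((one.add pF).add pG).add (pF.mul pG))),
      hF.binary hG (fun k => .div k k (k + 1)) (· / ·) (fun _ _ => rfl) (fun _ _ => rfl)
        (fun u v => (Nat.div_le_self u v).trans (by omega)) (fun _ _ => rfl) fun _ _ _ => rfl⟩
  | load a iha =>
    obtain ⟨F, pF, hF⟩ := iha
    exact ⟨_, pF.add (((one.add pF).add X).add (((one.add pF).add pF).add ((one.add pF).add X))),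
      hF.load⟩
  | bind a b iha ihb =>
    obtain ⟨F, pF, hF⟩ := iha
    obtain ⟨G, pG, hG⟩ := ihb
    have p := pG.comp (X.add pF)
    exact ⟨_, pF.add (p.add (one.add p)), hF.bind hG⟩
  | iter n cap body ihn ihc ihb =>
    obtain ⟨F, pF, hF⟩ := ihn
    obtain ⟨G, pG, hG⟩ := ihc
    obtain ⟨H, pH, hH⟩ := ihb
    have p := pH.comp ((X.add pF).add pG)
    exact ⟨_, pF.add (pG.add (one.add (one.add (((pF.mul ((one.add pF).add (p.add
      (((one.add p).add pG).add (((one.add p).add p).add (two.add ((two.add pF).add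
        (two.add pF)))))))).add one).add (one.add pG))))), hF.iter hG hH⟩

end Expr

end RAM

namespace RAM

/-! ### Running a program on a shifted memory -/

/-- All registers of an instruction are below `K`. -/
def Instr.Below (K : ℕ) : Instr → Prop
  | .const r _ => r < K
  | .copy r a => r < K ∧ a < K
  | .add r a b => r < K ∧ a < K ∧ b < K
  | .sub r a b => r < K ∧ a < K ∧ b < K
  | .mul r a b => r < K ∧ a < K ∧ b < K
  | .div r a b => r < K ∧ a < K ∧ b < K
  | .load r a => r < K ∧ a < K
  | .store a b => a < K ∧ b < K

/-- All registers of a program are below `K`. -/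
def Prog.Below (K : ℕ) : Prog → Prop
  | .skip => True
  | .instr i => i.Below K
  | .seq p q => p.Below K ∧ q.Below K
  | .ite r p q => r < K ∧ p.Below K ∧ q.Below K
  | .loop r p => r < K ∧ p.Below K

theorem Prog.exists_below (p : Prog) : ∃ K₀, ∀ K ≥ K₀, p.Below K := by
  induction p with
  | skip => exact ⟨0, fun _ _ => trivial⟩
  | instr i =>
    cases i with
    | const r c => exact ⟨r + 1, fun K hK => show r < K by omega⟩
    | copy r a => exact ⟨r + a + 1, fun K hK => ⟨by omega, by omega⟩⟩
    | add r a b => exact ⟨r + a + b + 1, fun K hK => ⟨by omega, by omega, by omega⟩⟩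
    | sub r a b => exact ⟨r + a + b + 1, fun K hK => ⟨by omega, by omega, by omega⟩⟩
    | mul r a b => exact ⟨r + a + b + 1, fun K hK => ⟨by omega, by omega, by omega⟩⟩
    | div r a b => exact ⟨r + a + b + 1, fun K hK => ⟨by omega, by omega, by omega⟩⟩
    | load r a => exact ⟨r + a + 1, fun K hK => ⟨by omega, by omega⟩⟩
    | store a b => exact ⟨a + b + 1, fun K hK => ⟨by omega, by omega⟩⟩
  | seq p q ihp ihq =>
    obtain ⟨K, hK⟩ := ihp
    obtain ⟨L, hL⟩ := ihq
    exact ⟨K + L, fun M hM => ⟨hK M (by omega), hL M (by omega)⟩⟩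
  | ite r p q ihp ihq =>
    obtain ⟨K, hK⟩ := ihp
    obtain ⟨L, hL⟩ := ihq
    exact ⟨r + K + L + 1, fun M hM => ⟨by omega, hK M (by omega), hL M (by omega)⟩⟩
  | loop r p ihp =>
    obtain ⟨K, hK⟩ := ihp
    exact ⟨r + K + 1, fun M hM => ⟨by omega, hK M (by omega)⟩⟩

/-- The program `p` with all memory addresses increased by the contents of the register `K + 1`.
The register `K` holds the shifted addresses. -/
def Prog.shift (K : ℕ) : Prog → Prog
  | .skip => .skip
  | .instr (.load r a) => .seq (.instr (.add K a (K + 1))) (.instr (.load r K))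
  | .instr (.store a b) => .seq (.instr (.add K a (K + 1))) (.instr (.store K b))
  | .instr i => .instr i
  | .seq p q => .seq (p.shift K) (q.shift K)
  | .ite r p q => .ite r (p.shift K) (q.shift K)
  | .loop r p => .loop r (p.shift K)

/-- The state `u` contains the state `s`: the registers below `K` agree, and the memory of `s` is
found in `u` from the address `B` on, which the register `K + 1` of `u` holds. -/
structure Contains (K B : ℕ) (s u : State) : Prop where
  reg : ∀ r < K, u.reg r = s.reg r
  base : u.reg (K + 1) = B
  mem : ∀ a, u.mem (a + B) = s.mem a

theorem Contains.setReg {K B : ℕ} {s u : State} (h : Contains K B s u) {r : ℕ} (hr : r < K)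
    (v : ℕ) : Contains K B (s.setReg r v) (u.setReg r v) where
  reg := fun r' hr' => by
    by_cases e : r' = r
    · subst e; simp [State.setReg]
    · simp [State.setReg, Function.update_of_ne e, h.reg r' hr']
  base := by simp [State.setReg, Function.update_of_ne (show K + 1 ≠ r by omega), h.base]
  mem := h.mem

theorem Contains.setTemp {K B : ℕ} {s u : State} (h : Contains K B s u) (v : ℕ) :
    Contains K B s (u.setReg K v) where
  reg := fun r hr => by simp [State.setReg, Function.update_of_ne hr.ne, h.reg r hr]
  base := by simp [State.setReg, h.base]
  mem := h.mem

theorem Contains.setMem {K B : ℕ} {s u : State} (h : Contains K B s u) (a v : ℕ) :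
    Contains K B (s.setMem a v) (u.setMem (a + B) v) where
  reg := h.reg
  base := h.base
  mem := fun a' => by
    by_cases e : a' = a
    · subst e; simp [State.setMem]
    · simp [State.setMem, Function.update_of_ne e, h.mem,
        Function.update_of_ne (show a' + B ≠ a + B by omega)]

theorem size_add_le (a B : ℕ) : (a + B).size ≤ a.size + B := by
  rw [Nat.size_le, pow_add]
  have h1 := Nat.lt_size_self a
  have h2 : B + 1 ≤ 2 ^ B := Nat.lt_two_pow_self
  nlinarith [Nat.mul_le_mul_left (2 ^ a.size) h2, Nat.one_le_two_pow (n := a.size),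
    Nat.le_mul_of_pos_left B (Nat.two_pow_pos a.size)]

/-- A run of `p` is simulated by its shifted version, which is slower by a factor that depends on
the distance of the shift. -/
theorem Exec.shift {K B : ℕ} {p : Prog} {s s' : State} {t : ℕ} (e : Exec p s t s')
    (hp : p.Below K) {u : State} (h : Contains K B s u) :
    ∃ u', Runs (p.shift K) u ((3 + 2 * B) * t) u' ∧ Contains K B s' u' := by
  induction e generalizing u with
  | skip s => exact ⟨u, ⟨0, by omega, .skip u⟩, h⟩
  | instr i s =>
    have key : ∀ c : ℕ, c ≤ (3 + 2 * B) * c := fun c => Nat.le_mul_of_pos_left c (by omega)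
    cases i with
    | const r c => exact ⟨_, .instr (key _), h.setReg hp c⟩
    | copy r a =>
      refine ⟨_, .instr ?_, ?_⟩
      · simp only [Instr.cost, h.reg a hp.2]; exact key _
      · simp only [Instr.run, h.reg a hp.2]; exact h.setReg hp.1 _
    | add r a b =>
      refine ⟨_, .instr ?_, ?_⟩
      · simp only [Instr.cost, h.reg a hp.2.1, h.reg b hp.2.2]; exact key _
      · simp only [Instr.run, h.reg a hp.2.1, h.reg b hp.2.2]; exact h.setReg hp.1 _
    | sub r a b =>
      refine ⟨_, .instr ?_, ?_⟩
      · simp only [Instr.cost, h.reg a hp.2.1, h.reg b hp.2.2]; exact key _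
      · simp only [Instr.run, h.reg a hp.2.1, h.reg b hp.2.2]; exact h.setReg hp.1 _
    | mul r a b =>
      refine ⟨_, .instr ?_, ?_⟩
      · simp only [Instr.cost, h.reg a hp.2.1, h.reg b hp.2.2]; exact key _
      · simp only [Instr.run, h.reg a hp.2.1, h.reg b hp.2.2]; exact h.setReg hp.1 _
    | div r a b =>
      refine ⟨_, .instr ?_, ?_⟩
      · simp only [Instr.cost, h.reg a hp.2.1, h.reg b hp.2.2]; exact key _
      · simp only [Instr.run, h.reg a hp.2.1, h.reg b hp.2.2]; exact h.setReg hp.1 _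
    | load r a =>
      refine ⟨_, Runs.mono (.seq (.instr le_rfl) (.instr le_rfl)) ?_, ?_⟩
      · have := size_add_le (s.reg a) B
        have := size_le_self B
        simp [Instr.cost, Instr.run, State.setReg, h.reg a hp.2, h.base, h.mem]
        ring_nf
        omega
      · simp only [Instr.run, h.reg a hp.2, h.base]
        have h' := h.setTemp (s.reg a + B)
        convert h'.setReg hp.1 (s.mem (s.reg a)) using 2
        simp [State.setReg, h.mem]
    | store a b =>
      have hb : b ≠ K := hp.2.ne
      refine ⟨_, Runs.mono (.seq (.instr le_rfl) (.instr le_rfl)) ?_, ?_⟩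
      · have := size_add_le (s.reg a) B
        have := size_le_self B
        simp [Instr.cost, Instr.run, State.setReg, h.reg a hp.1, h.base,
          h.reg b hp.2, Function.update_of_ne hb]
        ring_nf
        omega
      · simp only [Instr.run, h.reg a hp.1, h.base]
        have h' := h.setTemp (s.reg a + B)
        convert h'.setMem (s.reg a) (s.reg b) using 2
        · simp [State.setReg]
        · simp [State.setReg, Function.update_of_ne hb, h.reg b hp.2]
  | seq _ _ ih₁ ih₂ =>
    obtain ⟨u₁, e₁, h₁⟩ := ih₁ hp.1 h
    obtain ⟨u₂, e₂, h₂⟩ := ih₂ hp.2 h₁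
    exact ⟨u₂, (e₁.seq e₂).mono (by rw [mul_add]), h₂⟩
  | @ite_true r p q s s' t hr _ ih =>
    obtain ⟨u₁, ⟨t₁, ht, e₁⟩, h₁⟩ := ih hp.2.1 h
    have hu := h.reg r hp.1
    refine ⟨u₁, ⟨_, ?_, .ite_true _ (by rwa [hu]) e₁⟩, h₁⟩
    rw [hu, mul_add]
    have := Nat.le_mul_of_pos_left (1 + (s.reg r).size) (show 0 < 3 + 2 * B by omega)
    omega
  | @ite_false r p q s s' t hr _ ih =>
    obtain ⟨u₁, ⟨t₁, ht, e₁⟩, h₁⟩ := ih hp.2.2 h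
    have hu := h.reg r hp.1
    refine ⟨u₁, ⟨_, ?_, .ite_false _ (by rwa [hu]) e₁⟩, h₁⟩
    rw [hu, mul_add]
    have := Nat.le_mul_of_pos_left (1 + (s.reg r).size) (show 0 < 3 + 2 * B by omega)
    omega
  | @loop_done r p s hr =>
    have hu := h.reg r hp.1
    refine ⟨u, ⟨_, ?_, .loop_done _ (by rwa [hu])⟩, h⟩
    rw [hu]
    exact Nat.le_mul_of_pos_left _ (by omega)
  | @loop_step r p s s' s'' t v hr _ _ ih₁ ih₂ =>
    obtain ⟨u₁, ⟨t₁, ht₁, e₁⟩, h₁⟩ := ih₁ hp.2 h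
    obtain ⟨u₂, ⟨t₂, ht₂, e₂⟩, h₂⟩ := ih₂ hp h₁
    have hu := h.reg r hp.1
    refine ⟨u₂, ⟨_, ?_, .loop_step (by rwa [hu]) e₁ e₂⟩, h₂⟩
    rw [hu, mul_add, mul_add]
    have := Nat.le_mul_of_pos_left (1 + (s.reg r).size) (show 0 < 3 + 2 * B by omega)
    omega

/-! ### Reductions given by expressions -/

/-- The list of `len` entries whose entry at position `i` is the value of `ent` at `i`. -/
def listOf (len ent : Expr) (x : List ℕ) : List ℕ :=
  (List.range (len.eval x fun _ => x.length)).map fun i => ent.eval x fun _ => i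

/-- Reductions that are given by expressions can be carried out by a random access machine: for
each program `p` there is a program that turns its input `x` into the list `listOf len ent x` and
runs `p` on it, with polynomial overhead. -/
theorem exists_reduction (p : Prog) (len ent : Expr) :
    ∃ (r : Prog) (F : ℕ → ℕ), PolyBdd F ∧
      ∀ X x, 2 ≤ X → x.length ≤ X → (∀ a ∈ x, a ≤ X) →
        ((listOf len ent x).length ≤ F X ∧ ∀ a ∈ listOf len ent x, a ≤ F X) ∧
        ∀ t s', Exec p (input (listOf len ent x)) t s' →
          ∃ u, Runs r (input x) (F X + F X * t) u ∧ u.reg 0 = s'.reg 0 := by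
  obtain ⟨K₀, hK₀⟩ := p.exists_below
  obtain ⟨F, pF, hF⟩ := len.exists_evaluates
  obtain ⟨G, pG, hG⟩ := ent.exists_evaluates
  set K := K₀ + 1 with hK
  have hp : p.Below K := hK₀ K (by omega)
  -- the body of the loop that writes the new list
  let body : Prog := .seq (ent.compile (K + 2) (fun _ => K + 4) (K + 5))
    (.seq (.instr (.add (K + 6) (K + 1) (K + 4))) (.seq (.instr (.store (K + 6) (K + 5)))
    (.seq (.instr (.const (K + 6) 1)) (.seq (.instr (.add (K + 4) (K + 4) (K + 6)))
      (.instr (.sub (K + 3) (K + 3) (K + 6)))))))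
  let r : Prog := .seq (.instr (.copy (K + 2) 0)) (.seq (.instr (.const K 1))
    (.seq (.instr (.add (K + 1) (K + 2) K)) (.seq (len.compile (K + 2) (fun _ => K + 2) (K + 3))
    (.seq (.instr (.copy 0 (K + 3))) (.seq (.instr (.const (K + 4) 0))
    (.seq (.loop (K + 3) body) (p.shift K)))))))
  -- a bound for one round
  let T : ℕ → ℕ := fun X => G (X + F X) + ((3 + X + F X) + ((2 + X + F X + G (X + F X)) +
    (2 + (2 + F X + (2 + F X)))))
  have c := PolyBdd.const
  have pX := PolyBdd.id
  have pGX := pG.comp (pX.add pF)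
  have pT : PolyBdd T := pGX.add ((((c 3).add pX).add pF).add
    (((((c 2).add pX).add pF).add pGX).add ((c 2).add (((c 2).add pF).add ((c 2).add pF)))))
  refine ⟨r, fun X => (1 + X) + (2 + ((2 + X) + (F X + ((1 + F X) + (1 +
    ((F X * (1 + F X + T X) + 1) + (G (X + F X) + (3 + 2 * (X + 1))))))))),
    ((c 1).add pX).add ((c 2).add (((c 2).add pX).add (pF.add (((c 1).add pF).add ((c 1).add
      (((pF.mul (((c 1).add pF).add pT)).add (c 1)).add (pGX.add
        ((c 3).add ((c 2).mul (pX.add (c 1))))))))))), ?_⟩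
  intro X x hX hlen hx
  beta_reduce
  -- the preparation
  set B := x.length + 1 with hB
  let s₁ : State := (Instr.add (K + 1) (K + 2) K).run ((Instr.const K 1).run
    ((Instr.copy (K + 2) 0).run (input x)))
  have s₁z : s₁.reg (K + 2) = x.length := by simp [s₁, Instr.run, State.setReg, input]
  have s₁B : s₁.reg (K + 1) = B := by simp [s₁, Instr.run, State.setReg, input, hB]
  have s₁r : ∀ r < K, s₁.reg r = if r = 0 then x.length else 0 := fun r hr => by
    simp [s₁, Instr.run, State.setReg, input, Function.update_of_ne hr.ne,
      Function.update_of_ne (show r ≠ K + 1 by omega),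
      Function.update_of_ne (show r ≠ K + 2 by omega)]
  have s₁m : s₁.mem = fun i => x.getD i 0 := rfl
  obtain ⟨ln, s₂, e₂, v₂, r₂, m₂⟩ := hF X x (K + 2) (fun _ => K + 2) (K + 3) (fun _ => x.length)
    s₁ ⟨hX, hlen, hx, by omega, s₁z, fun a _ => by rw [s₁m], fun _ => by omega, fun _ => s₁z,
      fun _ => hlen⟩
  set n := len.eval x (fun _ => x.length) with hn
  let s₃ : State := (Instr.const (K + 4) 0).run ((Instr.copy 0 (K + 3)).run s₂)
  -- the invariant of the loop
  let f : ℕ → ℕ := fun i => ent.eval x fun _ => i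
  let I : ℕ → State → Prop := fun i t => t.reg (K + 3) = n - i ∧ t.reg (K + 4) = i ∧
    t.reg (K + 2) = x.length ∧ t.reg (K + 1) = B ∧
    (∀ r < K, t.reg r = if r = 0 then n else 0) ∧
    (∀ a ≤ x.length, t.mem a = x.getD a 0) ∧ ∀ a, t.mem (a + B) = if a < i then f a else 0
  have hI : I 0 s₃ := by
    refine ⟨?_, ?_, ?_, ?_, ?_, ?_, ?_⟩
    · simp [s₃, Instr.run, State.setReg, v₂]
    · simp [s₃, Instr.run, State.setReg]
    · simp [s₃, Instr.run, State.setReg, r₂, s₁z]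
    · simp [s₃, Instr.run, State.setReg, r₂, s₁B]
    · intro r hr
      by_cases h0 : r = 0
      · subst h0; simp [s₃, Instr.run, State.setReg, v₂]
      · simp [s₃, Instr.run, State.setReg, Function.update_of_ne (show r ≠ K + 4 by omega), h0,
          r₂ r (by omega), s₁r r hr]
    · intro a _
      change s₂.mem a = _
      rw [m₂, s₁m]
    · intro a
      change s₂.mem (a + B) = _
      rw [m₂, s₁m]
      simp only [Nat.not_lt_zero, if_false]
      exact List.getD_eq_default _ _ (by omega)
  have ready : ∀ i t, i < n → I i t →
      Expr.Ready (X + F X) x (K + 2) (fun _ => K + 4) (K + 5) (fun _ => i) t := by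
    rintro i t hi ⟨-, t4, t2, -, -, tm, -⟩
    exact ⟨by omega, by omega, fun a ha => (hx a ha).trans (by omega), by omega, t2, tm,
      fun _ => by omega, fun _ => t4, fun _ => by omega⟩
  obtain ⟨s₄, e₄, h₄⟩ := Runs.loop (r := K + 3) (p := body) (n := n) (T := T X) (I := I)
    (fun i t h => h.1) (by
      intro i t hi h
      obtain ⟨lf, u, eu, vu, ru, mu⟩ := hG _ _ _ _ _ _ _ (ready i t hi h)
      obtain ⟨t3, t4, t2, t1, tr, tm, tm'⟩ := h
      have u4 : u.reg (K + 4) = i := by rw [ru _ (by omega), t4]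
      have u3 : u.reg (K + 3) = n - i := by rw [ru _ (by omega), t3]
      have u2 : u.reg (K + 2) = x.length := by rw [ru _ (by omega), t2]
      have u1 : u.reg (K + 1) = B := by rw [ru _ (by omega), t1]
      change u.reg (K + 5) = f i at vu
      change f i ≤ _ at lf
      refine ⟨_, eu.seq (.seq (.instr ?_) (.seq (.instr ?_) (.seq (.instr ?_) (.seq (.instr ?_)
        (.instr ?_))))), ?_, ?_, ?_, ?_, ?_, ?_, ?_⟩
      · simp only [Instr.cost, u1, u4]
        have := size_le_self B
        have := size_le_self i
        omega
      · simp [Instr.cost, Instr.run, State.setReg, u1, u4, vu]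
        have := size_le_self (B + i)
        have := size_le_self (f i)
        omega
      · simp [Instr.cost]
      · simp [Instr.cost, Instr.run, State.setReg, State.setMem, u4]
        have := size_le_self i
        omega
      · simp [Instr.cost, Instr.run, State.setReg, State.setMem, u3]
        have := size_le_self (n - i)
        omega
      · simp [Instr.run, State.setReg, State.setMem, u3]; omega
      · simp [Instr.run, State.setReg, State.setMem, u4]
      · simp [Instr.run, State.setReg, State.setMem, u2]
      · simp [Instr.run, State.setReg, State.setMem, u1]
      · intro r hr
        rw [← tr r hr, ← ru r (by omega)]
        simp [Instr.run, State.setReg, State.setMem,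
          Function.update_of_ne (show r ≠ K + 3 by omega),
          Function.update_of_ne (show r ≠ K + 4 by omega),
          Function.update_of_ne (show r ≠ K + 6 by omega)]
      · intro a ha
        rw [← tm a ha, ← mu]
        simp [Instr.run, State.setReg, State.setMem, u1, u4,
          Function.update_of_ne (show a ≠ B + i by omega)]
      · intro a
        by_cases ha : a = i
        · subst ha
          simp [Instr.run, State.setReg, State.setMem, u1, u4, vu, add_comm a B]
        · have : (a < i + 1) = (a < i) := by apply propext; omega
          simp only [this]
          rw [← tm' a, ← mu]
          simp [Instr.run, State.setReg, State.setMem, u1, u4,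
            Function.update_of_ne (show a + B ≠ B + i by omega)]) hI
  obtain ⟨-, -, -, w1, wr, -, wm⟩ := h₄
  have hy : (listOf len ent x).length = n := by simp [listOf, hn]
  have lf : ∀ i < n, f i ≤ G (X + F X) := fun i hi => by
    -- any state that is prepared for the evaluation serves to read off the bound
    let t : State := ⟨fun r => if r = K + 4 then i else x.length, fun a => x.getD a 0⟩
    exact (hG (X + F X) x (K + 2) (fun _ => K + 4) (K + 5) (fun _ => i) t
      ⟨by omega, by omega, fun a ha => (hx a ha).trans (by omega), by omega, by simp [t],
        fun _ _ => rfl, fun _ => by omega, fun _ => by simp [t], fun _ => by omega⟩).1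
  refine ⟨⟨by omega, fun a ha => ?_⟩, fun t s' hp' => ?_⟩
  · obtain ⟨i, hi, rfl⟩ := List.mem_map.1 ha
    exact (lf i (by simpa using hi)).trans (by omega)
  have hcont : Contains K B (input (listOf len ent x)) s₄ := by
    refine ⟨fun r hr => by rw [wr r hr]; simp [input, hy], w1, fun a => ?_⟩
    rw [wm a]
    by_cases ha : a < n
    · simp [input, listOf, ha, f, ← hn]
    · simp [input, listOf, ha, ← hn]
  obtain ⟨u, eu, hu⟩ := hp'.shift hp hcont
  refine ⟨u, Runs.mono (.seq (.instr (T := 1 + X) ?_) (.seq (.instr (T := 2) ?_)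
    (.seq (.instr (T := 2 + X) ?_) (.seq e₂ (.seq (.instr (T := 1 + F X) ?_)
      (.seq (.instr (T := 1) ?_) (.seq e₄ eu))))))) ?_, hu.reg 0 (by omega)⟩
  · have := size_le_self x.length
    simp [Instr.cost, input]
    omega
  · simp [Instr.cost]
  · have := size_le_self x.length
    simp [Instr.cost, Instr.run, State.setReg, input]
    omega
  · have := size_le_self n
    simp only [Instr.cost, v₂]
    omega
  · simp [Instr.cost]
  · have h1 : n * (1 + n + T X) ≤ F X * (1 + F X + T X) := by gcongr
    have h2 : (3 + 2 * B) * t ≤ (1 + X + (2 + (2 + X + (F X + (1 + F X + (1 +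
        (F X * (1 + F X + T X) + 1 + (G (X + F X) + (3 + 2 * (X + 1)))))))))) * t :=
      Nat.mul_le_mul_right _ (by omega)
    omega

end RAM

/-! ### Hitting sets as vertex covers -/

/-- The graph that expresses the problem to hit each set `M s` with `req s` by elements of `V`.
It has a vertex for each element, and for each index `s` a clique with one vertex `(s, v)` for each
element `v`. If `req s` holds, then `(s, v)` is adjacent to the element `v` if `v ∈ M s`, and to all
elements if `v ∉ M s`; the latter makes `(s, v)` useless, so that all cliques have the same size.
A vertex cover omits at most one vertex of each clique, and the elements adjacent to this
vertex belong to the cover. -/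
def hittingGraph {V I : Type} (req : I → Prop) (M : I → Set V) : SimpleGraph (V ⊕ I × V) where
  Adj
    | .inl _, .inl _ => False
    | .inl u, .inr (s, v) => req s ∧ (u = v ∨ v ∉ M s)
    | .inr (s, v), .inl u => req s ∧ (u = v ∨ v ∉ M s)
    | .inr (s, u), .inr (s', v) => s = s' ∧ u ≠ v
  symm := ⟨by
    rintro (u | ⟨s, u⟩) (v | ⟨s', v⟩) h
    · exact h
    · exact h
    · exact h
    · exact ⟨h.1.symm, h.2.symm⟩⟩
  loopless := ⟨by
    rintro (u | ⟨s, u⟩) h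
    · exact h
    · exact h.2 rfl⟩

namespace hittingGraph

variable {V I : Type} {req : I → Prop} {M : I → Set V}

/-- A hitting set, together with all vertices of each clique but one that stands for an element
of the hitting set, is a vertex cover. -/
theorem exists_cover [Fintype V] [Fintype I] [DecidableEq V] [Nonempty V] (A : Finset V)
    (hA : ∀ s, req s → ∃ v ∈ A, v ∈ M s) :
    ∃ C : Finset (V ⊕ I × V), (hittingGraph req M).IsVertexCover (C : Set (V ⊕ I × V)) ∧
      C.card = A.card + Fintype.card I * (Fintype.card V - 1) := by
  classical
  have : ∀ s, ∃ v, req s → v ∈ A ∧ v ∈ M s := fun s => by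
    by_cases hs : req s
    · obtain ⟨v, hv⟩ := hA s hs
      exact ⟨v, fun _ => hv⟩
    · exact ⟨Classical.arbitrary V, fun h => absurd h hs⟩
  choose w hw using this
  refine ⟨A.disjSum (Finset.univ.biUnion fun s =>
    ({w s}ᶜ : Finset V).map ⟨Prod.mk s, Prod.mk_right_injective s⟩), ?_, ?_⟩
  · have key : ∀ s v, (Sum.inr (s, v) : V ⊕ I × V) ∈ A.disjSum (Finset.univ.biUnion fun s =>
        ({w s}ᶜ : Finset V).map ⟨Prod.mk s, Prod.mk_right_injective s⟩) ↔ v ≠ w s := by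
      simp
    rintro (u | ⟨s, u⟩) (v | ⟨s', v⟩) h
    · exact h.elim
    · by_cases hv : v = w s'
      · obtain ⟨h1, h2⟩ := h
        have := hw s' h1
        subst hv
        rcases h2 with rfl | h2
        · left; simpa using this.1
        · exact absurd this.2 h2
      · right; exact_mod_cast (key _ _).2 hv
    · by_cases hv : u = w s
      · obtain ⟨h1, h2⟩ := h
        have := hw s h1
        subst hv
        rcases h2 with rfl | h2
        · right; simpa using this.1
        · exact absurd this.2 h2
      · left; exact_mod_cast (key _ _).2 hv
    · obtain ⟨rfl, h⟩ := h
      by_cases hu : u = w s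
      · right; exact_mod_cast (key _ _).2 (by rintro rfl; exact h hu)
      · left; exact_mod_cast (key _ _).2 hu
  · rw [Finset.card_disjSum, Finset.card_biUnion]
    · simp [Finset.card_compl]
    · intro s _ s' _ hs
      rw [Function.onFun, Finset.disjoint_left]
      simp only [Finset.mem_map, Function.Embedding.coeFn_mk]
      rintro _ ⟨v, -, rfl⟩ ⟨v', -, h⟩
      exact hs (Prod.ext_iff.1 h).1.symm

/-- Conversely, a vertex cover of this size yields a hitting set. If the cover contains a whole clique,
then the additional vertex pays for an element that hits the
set. -/
theorem exists_hitting [Fintype V] [Fintype I] [Nonempty V] {C : Finset (V ⊕ I × V)} {t : ℕ}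
    (hC : (hittingGraph req M).IsVertexCover (C : Set (V ⊕ I × V)))
    (hcard : C.card ≤ t + Fintype.card I * (Fintype.card V - 1)) :
    ∃ A : Finset V, A.card ≤ t ∧ ∀ s, req s → (M s).Nonempty → ∃ v ∈ A, v ∈ M s := by
  classical
  have : ∀ s, ∃ v, (M s).Nonempty → v ∈ M s := fun s => by
    by_cases h : (M s).Nonempty
    · exact ⟨_, fun _ => h.some_mem⟩
    · exact ⟨Classical.arbitrary V, fun h' => absurd h' h⟩
  choose w hw using this
  let row : I → Finset V := fun s => {v | Sum.inr (s, v) ∈ C}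
  let P : Finset I := {s | row s = Finset.univ}
  have hrow : ∀ s v, v ∈ row s ↔ Sum.inr (s, v) ∈ C := fun s v => by simp [row]
  have hsum : C.card = C.toLeft.card + ∑ s, (row s).card := by
    rw [← Finset.card_toLeft_add_card_toRight]
    congr 1
    rw [← Finset.card_sigma]
    refine Finset.card_bij (fun p _ => ⟨p.1, p.2⟩) ?_ ?_ ?_
    · rintro ⟨s, v⟩ h
      simpa [hrow] using h
    · rintro ⟨s, v⟩ _ ⟨s', v'⟩ _ h
      simpa using h
    · rintro ⟨s, v⟩ h
      exact ⟨(s, v), by simpa [hrow] using h, rfl⟩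
  have hge : ∀ s, (Fintype.card V - 1) + (if s ∈ P then 1 else 0) ≤ (row s).card := by
    intro s
    have hV := Fintype.card_pos (α := V)
    by_cases hs : s ∈ P
    · have : row s = Finset.univ := by simpa [P] using hs
      rw [if_pos hs, this, Finset.card_univ]
      omega
    · rw [if_neg hs]
      have h1 : ((row s)ᶜ).card ≤ 1 := by
        rw [Finset.card_le_one]
        intro a ha b hb
        by_contra hab
        rw [Finset.mem_compl, hrow] at ha hb
        rcases hC (show (hittingGraph req M).Adj (.inr (s, a)) (.inr (s, b)) from
          ⟨rfl, hab⟩) with h | h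
        · exact ha (by exact_mod_cast h)
        · exact hb (by exact_mod_cast h)
      rw [Finset.card_compl] at h1
      omega
  have hP : C.toLeft.card + P.card ≤ t := by
    have := Finset.sum_le_sum fun s (_ : s ∈ Finset.univ) => hge s
    rw [Finset.sum_add_distrib] at this
    simp at this
    omega
  refine ⟨C.toLeft ∪ P.image w, (Finset.card_union_le _ _).trans
    ((Nat.add_le_add_left Finset.card_image_le _).trans hP), fun s hs hM => ?_⟩
  by_cases hsP : s ∈ P
  · exact ⟨w s, Finset.mem_union_right _ (Finset.mem_image_of_mem w hsP), hw s hM⟩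
  · have : ∃ v, v ∉ row s := by
      by_contra! h
      exact hsP (by simpa [P] using Finset.eq_univ_iff_forall.2 h)
    obtain ⟨v, hv⟩ := this
    rw [hrow] at hv
    have adj : ∀ u, (u = v ∨ v ∉ M s) → u ∈ C.toLeft := fun u hu => by
      rcases hC (show (hittingGraph req M).Adj (.inr (s, v)) (.inl u) from ⟨hs, hu⟩) with h | h
      · exact absurd (by exact_mod_cast h) hv
      · simpa using h
    by_cases hvM : v ∈ M s
    · exact ⟨v, Finset.mem_union_left _ (adj v (.inl rfl)), hvM⟩
    · exact ⟨w s, Finset.mem_union_left _ (adj _ (.inr hvM)), hw s hM⟩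

end hittingGraph

/-- A disjoint union of cliques is chordal. -/
theorem isChordal_of_trans {V : Type} {G : SimpleGraph V}
    (h : ∀ a b c, G.Adj a b → G.Adj b c → a ≠ c → G.Adj a c) : IsChordal G := by
  rintro m hm ⟨f⟩
  obtain ⟨m, rfl⟩ : ∃ k, m = k + 4 := ⟨m - 4, by omega⟩
  have h01 : (SimpleGraph.cycleGraph (m + 4)).Adj 0 1 := by
    rw [SimpleGraph.cycleGraph_adj]; right; simp
  have h12 : (SimpleGraph.cycleGraph (m + 4)).Adj 1 2 := by
    rw [SimpleGraph.cycleGraph_adj]; right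
    rw [sub_eq_iff_eq_add]; rfl
  have h02 : ¬ (SimpleGraph.cycleGraph (m + 4)).Adj 0 2 := by
    rw [SimpleGraph.cycleGraph_adj]
    have v1 : ((1 : Fin (m + 2 + 2)) : ℕ) = 1 := rfl
    have v2 : ((2 : Fin (m + 2 + 2)) : ℕ) = 2 := rfl
    rintro (h | h) <;> rw [sub_eq_iff_eq_add, Fin.ext_iff] at h
    · rw [Fin.val_add] at h
      change 0 = (1 + 2) % (m + 4) at h
      rw [Nat.mod_eq_of_lt (by omega)] at h
      omega
    · rw [Fin.val_add] at h
      change 2 = (1 + 0) % (m + 4) at h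
      rw [Nat.mod_eq_of_lt (by omega)] at h
      omega
  refine h02 (f.map_rel_iff.1 (h _ _ _ (f.map_rel_iff.2 h01) (f.map_rel_iff.2 h12) ?_))
  intro e
  have := congrArg Fin.val (f.injective e)
  change 0 = 2 at this
  omega

/-! ### Satisfying assignments as hitting sets -/

/-- An encoding of the assignments of a block of `β` variables by subsets of size `h` of a block of
`γ` elements. Sets of equal size form an antichain, so that "contains the code of `α`" determines
`α`. -/
structure BlockCode (β γ h : ℕ) where
  code : (Fin β → Bool) → Finset (Fin γ)
  injective : Function.Injective code
  card : ∀ α, (code α).card = h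

namespace BlockCode

theorem nonempty {β γ h : ℕ} (hle : 2 ^ β ≤ γ.choose h) : Nonempty (BlockCode β γ h) := by
  have : Fintype.card (Fin β → Bool) ≤
      Fintype.card (Finset.powersetCard h (Finset.univ : Finset (Fin γ))) := by
    simpa using hle
  obtain ⟨f⟩ := Function.Embedding.nonempty_of_card_le this
  exact ⟨⟨fun α => (f α).1, fun a b hab => f.injective (Subtype.ext hab),
    fun α => (Finset.mem_powersetCard.1 (f α).2).2⟩⟩

variable {β γ h : ℕ} (κ : BlockCode β γ h)

/-- Every code meets the set `N`. -/
def Heavy (N : Finset (Fin γ)) : Prop := ∀ α, ¬ Disjoint (κ.code α) N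

/-- Every assignment whose code avoids `N` falsifies the literal `(p, b)`. -/
def Falsified (N : Finset (Fin γ)) (p : Fin β) (b : Bool) : Prop :=
  ∀ α, Disjoint (κ.code α) N → α p ≠ b

variable {q L : ℕ} {I : Type}

/-- The sets that have to be hit. The set with index `s` has the part `mask s j` in the block `j`.
It has to be hit if its part in some block meets all codes, or if missing it determines assignments
of some blocks that violate a clause. The variable `x` is number `pos x` in the block `blk x`. -/
def Required (φ : QSAT q) (blk : Fin φ.n → Fin L) (pos : Fin φ.n → Fin β)
    (mask : I → Fin L → Finset (Fin γ)) (s : I) : Prop :=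
  (∃ j, κ.Heavy (mask s j)) ∨
    ∃ c ∈ φ.clauses, ∀ l ∈ c, κ.Falsified (mask s (blk l.1)) (pos l.1) l.2

variable {φ : QSAT q} {blk : Fin φ.n → Fin L} {pos : Fin φ.n → Fin β}
  {mask : I → Fin L → Finset (Fin γ)}

/-- The codes of the parts of a satisfying assignment form a set of `h * L` elements that hits all
sets that have to be hit. -/
theorem exists_hitting (hinj : Function.Injective fun x => (blk x, pos x))
    (hφ : φ.Satisfiable) :
    ∃ A : Finset (Fin L × Fin γ), A.card = h * L ∧
      ∀ s, κ.Required φ blk pos mask s → ∃ v ∈ A, v.2 ∈ mask s v.1 := by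
  classical
  obtain ⟨a, ha⟩ := hφ
  obtain ⟨α, hα⟩ : ∃ α : Fin L → Fin β → Bool, ∀ x, α (blk x) (pos x) = a x := by
    refine ⟨fun j p => Function.extend (fun x => (blk x, pos x)) a (fun _ => false) (j, p),
      fun x => ?_⟩
    exact hinj.extend_apply a _ x
  let A : Finset (Fin L × Fin γ) := {v | v.2 ∈ κ.code (α v.1)}
  have hit : ∀ s j, ¬ Disjoint (κ.code (α j)) (mask s j) → ∃ v ∈ A, v.2 ∈ mask s v.1 := by
    intro s j hj
    obtain ⟨p, hp, hp'⟩ := Finset.not_disjoint_iff.1 hj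
    exact ⟨(j, p), by simpa [A] using hp, hp'⟩
  refine ⟨A, ?_, ?_⟩
  · have : A.card = (Finset.univ.sigma fun j => κ.code (α j)).card := by
      refine Finset.card_bij (fun v _ => ⟨v.1, v.2⟩) ?_ ?_ ?_
      · intro v hv; simpa [A] using hv
      · rintro ⟨j, p⟩ _ ⟨j', p'⟩ _ e; simpa using e
      · rintro ⟨j, p⟩ hv; exact ⟨(j, p), by simpa [A] using hv, rfl⟩
    rw [this, Finset.card_sigma]
    simp [κ.card, mul_comm]
  · rintro s (⟨j, hj⟩ | ⟨c, hc, hl⟩)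
    · exact hit s j (hj _)
    · obtain ⟨l, hlc, hal⟩ := ha c hc
      refine hit s (blk l.1) fun hd => hl l hlc _ hd ?_
      rw [hα, hal]

/-- The converse holds if each choice of parts in at most `q` blocks occurs among the sets. The part
of `A` in each block contains a code, because its complement is not heavy, and equals it for reasons
of size; these codes give the satisfying assignment. Only nonempty sets are needed: the
complement of a code is nonempty because of `h < γ`. -/
theorem satisfiable (hq : 0 < q) (hL : 0 < L) (hγ : h < γ)
    (hmask : ∀ (N : Fin L → Finset (Fin γ)) (j : Fin q → Fin L),
      ∃ s, (∀ t, mask s (j t) = N (j t)) ∧ ∀ i, mask s i ⊆ N i)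
    {A : Finset (Fin L × Fin γ)} (hA : A.card ≤ h * L)
    (hit : ∀ s, κ.Required φ blk pos mask s → (∃ v : Fin L × Fin γ, v.2 ∈ mask s v.1) →
      ∃ v ∈ A, v.2 ∈ mask s v.1) : φ.Satisfiable := by
  classical
  let B : Fin L → Finset (Fin γ) := fun j => {p | (j, p) ∈ A}
  have hB : ∀ j p, p ∈ B j ↔ (j, p) ∈ A := fun j p => by simp [B]
  -- an index whose set avoids `A` cannot be required
  have avoid : ∀ s, (∀ i, mask s i ⊆ (B i)ᶜ) → (∃ j, (mask s j).Nonempty) →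
      ¬ κ.Required φ blk pos mask s := by
    rintro s hs ⟨j, p, hp⟩ hr
    obtain ⟨v, hv, hv'⟩ := hit s hr ⟨(j, p), hp⟩
    have := hs _ hv'
    rw [Finset.mem_compl, hB] at this
    exact this hv
  have hsub : ∀ j, ∃ α, κ.code α ⊆ B j := by
    intro j
    obtain ⟨s, hs, hs'⟩ := hmask (fun i => (B i)ᶜ) fun _ => j
    have hsj := hs ⟨0, hq⟩
    by_contra! hno
    have hheavy : κ.Heavy (mask s j) := fun α hd => by
      rw [hsj] at hd
      exact hno α (disjoint_compl_right_iff.1 hd)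
    refine avoid s hs' ⟨j, ?_⟩ (.inl ⟨j, hheavy⟩)
    by_contra hne
    rw [Finset.not_nonempty_iff_eq_empty] at hne
    exact hheavy (fun _ => false) (by rw [hne]; exact Finset.disjoint_empty_right _)
  choose α hα using hsub
  have hcard : A.card = ∑ j, (B j).card := by
    rw [← Finset.card_sigma]
    refine Finset.card_bij (fun v _ => ⟨v.1, v.2⟩) ?_ ?_ ?_
    · intro v hv; simpa [hB] using hv
    · rintro ⟨j, p⟩ _ ⟨j', p'⟩ _ e; simpa using e
    · rintro ⟨j, p⟩ hv; exact ⟨(j, p), by simpa [hB] using hv, rfl⟩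
  have hge : ∀ j, h ≤ (B j).card := fun j => by
    rw [← κ.card (α j)]; exact Finset.card_le_card (hα j)
  have heq : ∀ j, B j = κ.code (α j) := by
    intro j
    refine (Finset.eq_of_subset_of_card_le (hα j) ?_).symm
    rw [κ.card]
    by_contra! hlt
    have := Finset.sum_lt_sum (fun i _ => hge i) ⟨j, Finset.mem_univ j, hlt⟩
    rw [← hcard] at this
    simp only [Finset.sum_const, Finset.card_univ, Fintype.card_fin, smul_eq_mul] at this
    rw [mul_comm] at this
    omega
  refine ⟨fun x => α (blk x) (pos x), fun c hc => ?_⟩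
  by_contra! hno
  obtain ⟨s, hs, hs'⟩ := hmask (fun i => (B i)ᶜ)
    fun t => if ht : t.1 < c.length then blk (c.get ⟨t.1, ht⟩).1 else ⟨0, hL⟩
  refine avoid s hs' ?_ (.inr ⟨c, hc, fun l hl α' hd => ?_⟩)
  · have h0 := hs ⟨0, hq⟩
    refine ⟨_, by
      rw [h0, heq, ← Finset.card_pos, Finset.card_compl, κ.card, Fintype.card_fin]
      omega⟩
  · obtain ⟨t, ht, rfl⟩ := List.getElem_of_mem hl
    have := hs ⟨t, ht.trans_le (φ.length_le c hc)⟩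
    simp only [ht, dif_pos, List.get_eq_getElem] at this
    rw [this, disjoint_compl_right_iff, heq] at hd
    have := κ.injective (Finset.eq_of_subset_of_card_le hd (by rw [κ.card, κ.card]))
    rw [this]
    exact hno _ hl

end BlockCode

/-! ### Expressions for predicates -/

namespace RAM.Expr

/-- The expression `e` takes the value `1` if `P` holds, and `0` otherwise. -/
def Decides (x : List ℕ) (env : ℕ → ℕ) (e : Expr) (P : Prop) : Prop :=
  (P → e.eval x env = 1) ∧ (¬ P → e.eval x env = 0)

/-- Logical negation. -/
def not (a : Expr) : Expr := sub (const 1) a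

/-- Logical disjunction. -/
def or (a b : Expr) : Expr := not (mul (not a) (not b))

/-- The comparison `a ≤ b`. -/
def le (a b : Expr) : Expr := not (sub a b)

/-- The comparison `a = b`. -/
def eq (a b : Expr) : Expr := mul (le a b) (le b a)

/-- Case distinction on an expression with value `0` or `1`. -/
def ite (c a b : Expr) : Expr := add (mul c a) (mul (not c) b)

/-- The remainder of a division. -/
def mod (a b : Expr) : Expr := sub a (mul b (div a b))

/-- The power `a ^ t` with a fixed exponent. -/
def pow (a : Expr) : ℕ → Expr
  | 0 => const 1
  | t + 1 => mul (pow a t) a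

/-- Bounded existential quantification: in `body`, the variable `0` runs through the numbers below
`n`, and the other variables are shifted by `2`. -/
def ex (n body : Expr) : Expr := iter n (const 1) (add (var 1) body)

open Classical in
/-- Look-up of the value of `e` in a table with `len` entries that represents `P`. -/
noncomputable def table (P : ℕ → Prop) : ℕ → Expr → Expr
  | 0, _ => const 0
  | len + 1, e => if P len then or (eq e (const len)) (table P len e) else table P len e

variable {x : List ℕ} {env : ℕ → ℕ} {a b c : Expr} {P Q : Prop}

theorem Decides.not (h : a.Decides x env P) : (not a).Decides x env (¬ P) := by
  refine ⟨fun hP => ?_, fun hP => ?_⟩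
  · simp [Expr.not, eval, h.2 hP]
  · simp [Expr.not, eval, h.1 (not_not.1 hP)]

theorem Decides.and (h : a.Decides x env P) (h' : b.Decides x env Q) :
    (mul a b).Decides x env (P ∧ Q) := by
  refine ⟨fun hP => ?_, fun hP => ?_⟩
  · simp [eval, h.1 hP.1, h'.1 hP.2]
  · by_cases p : P
    · simp [eval, h'.2 fun q => hP ⟨p, q⟩]
    · simp [eval, h.2 p]

theorem Decides.congr (h : a.Decides x env P) (e : P ↔ Q) : a.Decides x env Q :=
  ⟨fun q => h.1 (e.2 q), fun q => h.2 fun p => q (e.1 p)⟩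

theorem Decides.or (h : a.Decides x env P) (h' : b.Decides x env Q) :
    (or a b).Decides x env (P ∨ Q) :=
  (h.not.and h'.not).not.congr (by tauto)

theorem decides_le (x : List ℕ) (env : ℕ → ℕ) (a b : Expr) :
    (le a b).Decides x env (a.eval x env ≤ b.eval x env) :=
  ⟨fun h => by simp [le, Expr.not, eval]; omega, fun h => by simp [le, Expr.not, eval]; omega⟩

theorem decides_eq (x : List ℕ) (env : ℕ → ℕ) (a b : Expr) :
    (eq a b).Decides x env (a.eval x env = b.eval x env) :=
  ((decides_le x env a b).and (decides_le x env b a)).congr (by omega)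

theorem Decides.eval_ite (h : c.Decides x env P) [Decidable P] (a b : Expr) :
    (ite c a b).eval x env = if P then a.eval x env else b.eval x env := by
  split_ifs with hP
  · simp [ite, Expr.not, eval, h.1 hP]
  · simp [ite, Expr.not, eval, h.2 hP]

theorem eval_mod (x : List ℕ) (env : ℕ → ℕ) (a b : Expr) :
    (mod a b).eval x env = a.eval x env % b.eval x env := (Nat.mod_def _ _).symm

theorem eval_pow (x : List ℕ) (env : ℕ → ℕ) (a : Expr) (t : ℕ) :
    (pow a t).eval x env = a.eval x env ^ t := by
  induction t with
  | zero => rfl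
  | succ t ih => rw [pow, eval, ih, pow_succ]

theorem decides_ex {n body : Expr} {R : ℕ → Prop}
    (h : ∀ i < n.eval x env, ∀ acc, body.Decides x (push i (push acc env)) (R i)) :
    (ex n body).Decides x env (∃ i < n.eval x env, R i) := by
  have key : ∀ N ≤ n.eval x env,
      ((∃ i < N, R i) → cappedRec 1 (fun i acc => acc + body.eval x (push i (push acc env))) N = 1)
      ∧ ((¬ ∃ i < N, R i) →
        cappedRec 1 (fun i acc => acc + body.eval x (push i (push acc env))) N = 0) := by
    intro N
    induction N with
    | zero => exact fun _ => ⟨fun ⟨i, hi, _⟩ => absurd hi (Nat.not_lt_zero i), fun _ => rfl⟩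
    | succ N ih =>
      intro hN
      obtain ⟨ih1, ih0⟩ := ih (by omega)
      rw [cappedRec]
      set acc := cappedRec 1 (fun i acc => acc + body.eval x (push i (push acc env))) N
      have hb := h N (by omega) acc
      refine ⟨?_, fun hno => ?_⟩
      · rintro ⟨i, hi, hR⟩
        rcases Nat.lt_succ_iff_lt_or_eq.1 hi with hi | rfl
        · have := ih1 ⟨i, hi, hR⟩
          simp [this]
        · simp [hb.1 hR]
      · have h1 := ih0 fun ⟨i, hi, hR⟩ => hno ⟨i, by omega, hR⟩
        have h2 := hb.2 fun hR => hno ⟨N, by omega, hR⟩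
        change min (acc + body.eval x (push N (push acc env))) 1 = 0
        rw [h2, h1]
        rfl
  exact key _ le_rfl

theorem decides_table (x : List ℕ) (env : ℕ → ℕ) (R : ℕ → Prop) (len : ℕ) (e : Expr) :
    (table R len e).Decides x env (e.eval x env < len ∧ R (e.eval x env)) := by
  induction len with
  | zero => exact ⟨fun h => absurd h.1 (Nat.not_lt_zero _), fun _ => rfl⟩
  | succ len ih =>
    rw [table]
    split_ifs with h
    · refine ((decides_eq x env e (const len)).or ih).congr ⟨?_, ?_⟩
      · rintro (h' | h')
        · change _ = len at h'
          rw [h']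
          exact ⟨by omega, h⟩
        · exact ⟨by omega, h'.2⟩
      · rintro ⟨h1, h2⟩
        rcases Nat.lt_succ_iff_lt_or_eq.1 h1 with h3 | h3
        · exact .inr ⟨h3, h2⟩
        · exact .inl h3
    · refine ih.congr ⟨fun h' => ⟨by omega, h'.2⟩, fun h' => ⟨?_, h'.2⟩⟩
      rcases Nat.lt_succ_iff_lt_or_eq.1 h'.1 with h3 | h3
      · exact h3
      · rw [h3] at h'
        exact absurd h'.2 h

end RAM.Expr

/-! ### Reading the encoding of a formula -/

/-- The entry number `i` of the part of a concatenation that comes from the entry number `c`. -/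
theorem List.getD_flatMap {α : Type} (f : α → List ℕ) (l : List α) {c i : ℕ} (hc : c < l.length)
    (hi : i < (f l[c]).length) :
    (l.flatMap f).getD (((l.take c).map fun a => (f a).length).sum + i) 0 = (f l[c])[i] := by
  have h1 : l.flatMap f = (l.take c).flatMap f ++ (f l[c] ++ (l.drop (c + 1)).flatMap f) := by
    have e : l = l.take c ++ l[c] :: l.drop (c + 1) := by
      rw [← List.drop_eq_getElem_cons hc, List.take_append_drop]
    conv_lhs => rw [e]
    rw [List.flatMap_append, List.flatMap_cons]
  rw [h1, ← List.length_flatMap, List.getD_append_right _ _ _ _ (by omega), Nat.add_sub_cancel_left,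
    List.getD_append _ _ _ _ hi, List.getD_eq_getElem _ _ hi]

namespace QSAT

variable {q : ℕ} (φ : QSAT q)

/-- The position in the encoding at which clause number `c` starts, not counting the two entries
for the number of variables and the number of clauses. -/
def offset (c : ℕ) : ℕ := ((φ.clauses.take c).map fun l => l.length + 1).sum

theorem offset_succ {c : ℕ} (hc : c < φ.clauses.length) :
    φ.offset (c + 1) = φ.offset c + 1 + φ.clauses[c].length := by
  unfold offset
  rw [List.take_add_one, List.getElem?_eq_getElem hc]
  simp only [List.map_append, List.sum_append, Option.toList_some, List.map_cons, List.map_nil,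
    List.sum_cons, List.sum_nil]
  omega

theorem offset_le {c : ℕ} (hc : c ≤ φ.clauses.length) : φ.offset c ≤ c * (q + 1) := by
  induction c with
  | zero => simp [offset]
  | succ c ih =>
    rw [offset_succ φ hc, add_mul]
    have := ih (by omega)
    have := φ.length_le _ (List.getElem_mem hc)
    omega

theorem getD_encode_one : φ.encode.getD 1 0 = φ.clauses.length := rfl

theorem getD_encode {c i : ℕ} (hc : c < φ.clauses.length) (hi : i < φ.clauses[c].length + 1) :
    φ.encode.getD (φ.offset c + i + 2) 0 =
      (φ.clauses[c].length :: φ.clauses[c].map fun l => 2 * l.1.val + l.2.toNat)[i]'(by simp; omega) := by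
  have := List.getD_flatMap (fun c : List (Fin φ.n × Bool) =>
    c.length :: c.map fun l => 2 * l.1.val + l.2.toNat) φ.clauses hc (i := i) (by simp; omega)
  simp only [List.length_cons, List.length_map] at this
  rw [← this]
  rfl

theorem getD_encode_length {c : ℕ} (hc : c < φ.clauses.length) :
    φ.encode.getD (φ.offset c + 2) 0 = φ.clauses[c].length :=
  φ.getD_encode hc (i := 0) (by omega)

theorem getD_encode_literal {c t : ℕ} (hc : c < φ.clauses.length) (ht : t < φ.clauses[c].length) :
    φ.encode.getD (φ.offset c + 3 + t) 0 =
      2 * φ.clauses[c][t].1.val + φ.clauses[c][t].2.toNat := by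
  have := φ.getD_encode hc (i := t + 1) (by omega)
  simp only [List.getElem_cons_succ, List.getElem_map] at this
  rw [← this]
  congr 1
  omega

theorem length_encode : φ.encode.length = 2 + φ.offset φ.clauses.length := by
  simp [encode, offset, List.length_flatMap]
  omega

theorem le_of_mem_encode {a : ℕ} (ha : a ∈ φ.encode) : a ≤ 2 * φ.n + φ.clauses.length + q := by
  simp only [encode, List.mem_cons, List.mem_flatMap, List.mem_map] at ha
  rcases ha with rfl | rfl | ⟨c, hc, rfl | ⟨l, -, rfl⟩⟩
  · omega
  · omega
  · have := φ.length_le c hc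
    omega
  · have := l.1.2
    have := Bool.toNat_le l.2
    omega

end QSAT

/-! ### The reduction as an expression -/

/-- The number of the mask that the index `s` assigns to the block `j`. The index consists of digits
to the base `D`, each of which names a block and a mask below `Γ`. The last of the first `t`
digits that names `j` is relevant, and `Γ` stands for the absence of such a digit. -/
def maskNumber (Γ D s j : ℕ) : ℕ → ℕ
  | 0 => Γ
  | t + 1 => if s / D ^ t % D / Γ = j then s / D ^ t % D % Γ else maskNumber Γ D s j t

theorem maskNumber_le {Γ : ℕ} (hΓ : 0 < Γ) (D s j t : ℕ) : maskNumber Γ D s j t ≤ Γ := by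
  induction t with
  | zero => exact le_rfl
  | succ t ih =>
    rw [maskNumber]
    split_ifs
    · exact (Nat.mod_lt _ hΓ).le
    · exact ih

/-- The subsets of a block, numbered from `0` to `2 ^ γ - 1`, and the empty set for all larger
numbers. -/
noncomputable def blockSet (γ μ : ℕ) : Finset (Fin γ) :=
  if h : μ < 2 ^ γ then (Fintype.equivFinOfCardEq (α := Finset (Fin γ)) (n := 2 ^ γ)
    (by simp)).symm ⟨μ, h⟩ else ∅

theorem exists_blockSet_eq {γ : ℕ} (N : Finset (Fin γ)) : ∃ μ < 2 ^ γ, blockSet γ μ = N := by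
  let e := Fintype.equivFinOfCardEq (α := Finset (Fin γ)) (n := 2 ^ γ) (by simp)
  exact ⟨e N, (e N).2, by simp [blockSet, e]⟩

theorem blockSet_self (γ : ℕ) : blockSet γ (2 ^ γ) = ∅ := by simp [blockSet]

/-- The part in the block `j` of the set with index `s`, for `L` blocks and `q` digits. -/
noncomputable def blockMask (γ L q s : ℕ) (j : Fin L) : Finset (Fin γ) :=
  blockSet γ (maskNumber (2 ^ γ) (L * 2 ^ γ) s j q)

/-- Each choice of parts in `q` blocks occurs among the sets. The blocks may be repeated; all other
parts of the set are empty. -/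
theorem exists_blockMask {γ L q : ℕ} (N : Fin L → Finset (Fin γ)) (j : Fin q → Fin L) :
    ∃ s : Fin ((L * 2 ^ γ) ^ q), (∀ t, blockMask γ L q s (j t) = N (j t)) ∧
      ∀ i, blockMask γ L q s i ⊆ N i := by
  choose μ hμ hN using fun i => exists_blockSet_eq (N i)
  have hΓ : 0 < 2 ^ γ := Nat.two_pow_pos γ
  let d : Fin q → Fin (L * 2 ^ γ) := fun t => ⟨(j t).1 * 2 ^ γ + μ (j t), by
    have h1 := (j t).2
    have h2 := hμ (j t)
    calc (j t).1 * 2 ^ γ + μ (j t) < ((j t).1 + 1) * 2 ^ γ := by rw [add_mul]; omega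
      _ ≤ L * 2 ^ γ := Nat.mul_le_mul_right _ h1⟩
  let s := finFunctionFinEquiv d
  have hs : ∀ t : Fin q, s.1 / (L * 2 ^ γ) ^ t.1 % (L * 2 ^ γ) = (j t).1 * 2 ^ γ + μ (j t) := by
    intro t
    have := congrFun (finFunctionFinEquiv.symm_apply_apply d) t
    exact congrArg Fin.val this
  have key : ∀ T ≤ q, ∀ i : Fin L,
      ((∃ t : Fin q, t.1 < T ∧ j t = i) → maskNumber (2 ^ γ) (L * 2 ^ γ) s i T = μ i) ∧
      ((¬ ∃ t : Fin q, t.1 < T ∧ j t = i) →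
        maskNumber (2 ^ γ) (L * 2 ^ γ) s i T = 2 ^ γ) := by
    intro T
    induction T with
    | zero => exact fun _ i => ⟨fun ⟨t, ht, _⟩ => absurd ht (Nat.not_lt_zero _), fun _ => rfl⟩
    | succ T ih =>
      intro hT i
      have hT' := hs ⟨T, hT⟩
      simp only at hT'
      have hdiv : ((j ⟨T, hT⟩).1 * 2 ^ γ + μ (j ⟨T, hT⟩)) / 2 ^ γ = (j ⟨T, hT⟩).1 := by
        rw [mul_comm, Nat.mul_add_div hΓ, Nat.div_eq_of_lt (hμ _), add_zero]
      have hmod : ((j ⟨T, hT⟩).1 * 2 ^ γ + μ (j ⟨T, hT⟩)) % 2 ^ γ = μ (j ⟨T, hT⟩) := by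
        rw [mul_comm, Nat.mul_add_mod, Nat.mod_eq_of_lt (hμ _)]
      rw [maskNumber, hT', hdiv, hmod]
      by_cases hi : j ⟨T, hT⟩ = i
      · rw [if_pos (congrArg Fin.val hi), hi]
        exact ⟨fun _ => rfl, fun h => absurd ⟨⟨T, hT⟩, Nat.lt_succ_self T, hi⟩ h⟩
      · rw [if_neg fun h => hi (Fin.ext h)]
        have : (∃ t : Fin q, t.1 < T + 1 ∧ j t = i) ↔ ∃ t : Fin q, t.1 < T ∧ j t = i := by
          refine ⟨fun ⟨t, ht, e⟩ => ⟨t, ?_, e⟩, fun ⟨t, ht, e⟩ => ⟨t, by omega, e⟩⟩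
          rcases Nat.lt_succ_iff_lt_or_eq.1 ht with h | h
          · exact h
          · exact absurd (by rw [← e]; congr 1; exact Fin.ext h.symm) hi
        rw [this]
        exact ih (by omega) i
  refine ⟨s, fun t => ?_, fun i => ?_⟩
  · rw [blockMask, (key q le_rfl (j t)).1 ⟨t, t.2, rfl⟩, hN]
  · rw [blockMask]
    by_cases hi : ∃ t : Fin q, t.1 < q ∧ j t = i
    · rw [(key q le_rfl i).1 hi, hN]
    · rw [(key q le_rfl i).2 hi, blockSet_self]
      exact Finset.empty_subset _

namespace QSAT

variable {q : ℕ} (φ : QSAT q) (β γ : ℕ)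

/-- The number of blocks, large enough for all variables. -/
def blocks : ℕ := φ.n / β + 1

/-- The number of elements of all blocks. -/
def elements : ℕ := φ.blocks β * γ

/-- The number of indices of sets. -/
def indices : ℕ := (φ.blocks β * 2 ^ γ) ^ q

/-- The number of vertices of the graph. -/
def vertices : ℕ := φ.elements β γ + φ.indices β γ * φ.elements β γ

/-- The block of a variable. -/
def blk (v : Fin φ.n) : Fin (φ.blocks β) :=
  ⟨v / β, Nat.lt_succ_of_le (Nat.div_le_div_right v.2.le)⟩

variable {β} in
/-- The position of a variable in its block. -/
def pos (hβ : 0 < β) (v : Fin φ.n) : Fin β := ⟨v % β, Nat.mod_lt _ hβ⟩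

theorem blk_pos_injective (hβ : 0 < β) :
    Function.Injective fun v => (φ.blk β v, φ.pos hβ v) := by
  intro v w h
  have h1 : v.1 / β = w.1 / β := congrArg (fun p => p.1.1) h
  have h2 : v.1 % β = w.1 % β := congrArg (fun p => p.2.1) h
  rw [Fin.ext_iff, ← Nat.div_add_mod v.1 β, ← Nat.div_add_mod w.1 β, h1, h2]

end QSAT

namespace RAM.Expr

variable (q β γ : ℕ)

/-- The number of blocks. -/
def blocksE : Expr := add (div (load (const 0)) (const β)) (const 1)

/-- The number of elements. -/
def elementsE : Expr := mul (blocksE β) (const γ)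

/-- The base of the digits of an index. -/
def baseE : Expr := mul (blocksE β) (const (2 ^ γ))

/-- The number of indices. -/
def indicesE : Expr := pow (baseE β γ) q

/-- The number of vertices. -/
def verticesE : Expr := add (elementsE β γ) (mul (indicesE q β γ) (elementsE β γ))

/-- The expression for `maskNumber`. -/
def maskE (s j : Expr) : ℕ → Expr
  | 0 => const (2 ^ γ)
  | t + 1 => ite (eq (div (mod (div s (pow (baseE β γ) t)) (baseE β γ)) (const (2 ^ γ))) j)
      (mod (mod (div s (pow (baseE β γ) t)) (baseE β γ)) (const (2 ^ γ))) (maskE s j t)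

/-- The offset of clause number `c` in the encoding of a formula. -/
def offsetE (c : Expr) : Expr :=
  iter c (mul (load (const 1)) (const (q + 1)))
    (add (add (var 1) (const 1)) (load (add (var 1) (const 2))))

variable {φ : QSAT q}

theorem eval_blocksE (env : ℕ → ℕ) : (blocksE β).eval φ.encode env = φ.blocks β := rfl

theorem eval_elementsE (env : ℕ → ℕ) : (elementsE β γ).eval φ.encode env = φ.elements β γ := rfl

theorem eval_baseE (env : ℕ → ℕ) :
    (baseE β γ).eval φ.encode env = φ.blocks β * 2 ^ γ := rfl

theorem eval_indicesE (env : ℕ → ℕ) :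
    (indicesE q β γ).eval φ.encode env = φ.indices β γ := by
  rw [indicesE, eval_pow, eval_baseE]; rfl

theorem eval_verticesE (env : ℕ → ℕ) :
    (verticesE q β γ).eval φ.encode env = φ.vertices β γ := by
  rw [verticesE, eval, eval, eval_indicesE, eval_elementsE]; rfl

theorem eval_maskE (env : ℕ → ℕ) (s j : Expr) (t : ℕ) :
    (maskE β γ s j t).eval φ.encode env =
      maskNumber (2 ^ γ) (φ.blocks β * 2 ^ γ) (s.eval φ.encode env) (j.eval φ.encode env) t := by
  induction t with
  | zero => rfl
  | succ t ih =>
    rw [maskE, (decides_eq _ _ _ _).eval_ite, ih, maskNumber]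
    simp only [eval, eval_mod, eval_pow, eval_baseE]

theorem eval_offsetE {env : ℕ → ℕ} {e : Expr} {c : ℕ} (hc : c ≤ φ.clauses.length)
    (he : e.eval φ.encode env = c) : (offsetE q e).eval φ.encode env = φ.offset c := by
  rw [offsetE, eval, he]
  clear he
  induction c with
  | zero => rfl
  | succ c ih =>
    rw [cappedRec, ih (by omega)]
    simp only [eval, push_zero, push_one, QSAT.getD_encode_one]
    rw [φ.getD_encode_length (by omega), ← φ.offset_succ (by omega)]
    refine min_eq_left ((φ.offset_le hc).trans ?_)
    gcongr

variable {q β γ} {h : ℕ} (κ : BlockCode β γ h)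

/-- The test whether variable number `v` is the index of a set that has to be hit. -/
noncomputable def requiredE (q : ℕ) (v : ℕ) : Expr :=
  or (ex (blocksE β)
      (table (fun μ => κ.Heavy (blockSet γ μ)) (2 ^ γ + 1) (maskE β γ (var (v + 2)) (var 0) q)))
    (ex (load (const 1)) (not (ex (load (add (offsetE q (var 0)) (const 2)))
      (bind (load (add (add (offsetE q (var 2)) (const 3)) (var 0)))
        (not (table (fun k => ∃ p : Fin β, p.1 = k % (2 * β) / 2 ∧
            κ.Falsified (blockSet γ (k / (2 * β))) p (decide (k % 2 = 1)))
          ((2 ^ γ + 1) * (2 * β))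
          (add (mul (maskE β γ (var (v + 5)) (div (var 0) (const (2 * β))) q) (const (2 * β)))
            (mod (var 0) (const (2 * β))))))))))

theorem decides_requiredE (hβ : 0 < β) (env : ℕ → ℕ) (v : ℕ) :
    (requiredE κ q v).Decides φ.encode env
      (κ.Required φ (φ.blk β) (φ.pos hβ) (blockMask γ (φ.blocks β) q) (env v)) := by
  refine Decides.or ?_ ?_
  · refine (decides_ex (R := fun j => κ.Heavy (blockSet γ (maskNumber (2 ^ γ)
      (φ.blocks β * 2 ^ γ) (env v) j q))) fun j hj acc => (decides_table _ _ _ _ _).congr ?_).congr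
      ⟨?_, ?_⟩
    · rw [eval_maskE]
      have := maskNumber_le (Nat.two_pow_pos γ) (φ.blocks β * 2 ^ γ) (env v) j q
      simp only [eval, push_zero, push_succ]
      exact and_iff_right (by omega)
    · rintro ⟨j, hj, h⟩
      exact ⟨⟨j, hj⟩, h⟩
    · rintro ⟨j, h⟩
      exact ⟨j, j.2, h⟩
  · refine (decides_ex (R := fun c => ∀ hc : c < φ.clauses.length, ∀ l ∈ φ.clauses[c],
      κ.Falsified (blockMask γ (φ.blocks β) q (env v) (φ.blk β l.1)) (φ.pos hβ l.1) l.2)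
      fun c hc acc => ?_).congr ⟨?_, ?_⟩
    · change c < φ.clauses.length at hc
      have hlen : (load (add (offsetE q (var 0)) (const 2))).eval φ.encode
          (push c (push acc env)) = φ.clauses[c].length := by
        rw [eval, eval, eval_offsetE q hc.le rfl]
        exact φ.getD_encode_length hc
      refine (decides_ex (R := fun t => ∀ ht : t < φ.clauses[c].length,
        ¬ κ.Falsified (blockMask γ (φ.blocks β) q (env v) (φ.blk β φ.clauses[c][t].1))
          (φ.pos hβ φ.clauses[c][t].1) φ.clauses[c][t].2) fun t ht acc' => ?_).not.congr ?_
      · rw [hlen] at ht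
        have hlit : (load (add (add (offsetE q (var 2)) (const 3)) (var 0))).eval φ.encode
            (push t (push acc' (push c (push acc env)))) =
            2 * φ.clauses[c][t].1.1 + φ.clauses[c][t].2.toNat := by
          have := eval_offsetE q (env := push t (push acc' (push c (push acc env)))) hc.le
            (e := var 2) rfl
          simp only [eval, this, push_zero]
          exact φ.getD_encode_literal hc ht
        unfold Decides
        rw [eval, hlit]
        refine (decides_table _ _ _ _ _).not.congr ?_
        set l := φ.clauses[c][t] with hl
        have hb := Bool.toNat_le l.2
        have hdiv : (2 * l.1.1 + l.2.toNat) / (2 * β) = l.1 / β := by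
          rw [← Nat.div_div_eq_div_mul]; congr 1; omega
        have hmod : (2 * l.1.1 + l.2.toNat) % (2 * β) = 2 * (l.1 % β) + l.2.toNat := by
          have h1 := Nat.div_add_mod (2 * l.1.1 + l.2.toNat) (2 * β)
          rw [hdiv] at h1
          have h2 := Nat.div_add_mod l.1.1 β
          rw [mul_assoc] at h1
          omega
        simp only [eval, eval_maskE, eval_mod, push_zero, push_succ, hdiv, hmod]
        set μ := maskNumber (2 ^ γ) (φ.blocks β * 2 ^ γ) (env v) (l.1 / β) q with hμ
        have hμ' : μ ≤ 2 ^ γ := maskNumber_le (Nat.two_pow_pos γ) _ _ _ _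
        have hlt : 2 * (l.1 % β) + l.2.toNat < 2 * β := by
          have := Nat.mod_lt l.1.1 hβ
          omega
        have e1 : (μ * (2 * β) + (2 * (l.1 % β) + l.2.toNat)) / (2 * β) = μ := by
          rw [mul_comm, Nat.mul_add_div (by omega), Nat.div_eq_of_lt hlt, add_zero]
        have e2 : (μ * (2 * β) + (2 * (l.1 % β) + l.2.toNat)) % (2 * β) =
            2 * (l.1 % β) + l.2.toNat := by
          rw [mul_comm, Nat.mul_add_mod, Nat.mod_eq_of_lt hlt]
        have e3 : (μ * (2 * β) + (2 * (l.1 % β) + l.2.toNat)) % 2 = l.2.toNat := by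
          have : μ * (2 * β) = 2 * (μ * β) := by ring
          omega
        have e4 : decide (l.2.toNat = 1) = l.2 := by cases l.2 <;> rfl
        have e5 : (2 * (l.1.1 % β) + l.2.toNat) / 2 = l.1 % β := by omega
        have e6 : μ * (2 * β) + (2 * (l.1 % β) + l.2.toNat) < (2 ^ γ + 1) * (2 * β) := by
          calc _ < (μ + 1) * (2 * β) := by rw [add_mul]; omega
            _ ≤ _ := Nat.mul_le_mul_right _ (by omega)
        rw [e1, e2, e3, e4, e5]
        have e7 : (∃ p : Fin β, p.1 = l.1 % β ∧ κ.Falsified (blockSet γ μ) p l.2) ↔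
            κ.Falsified (blockSet γ μ) (φ.pos hβ l.1) l.2 := by
          refine ⟨?_, fun h => ⟨_, rfl, h⟩⟩
          rintro ⟨p, hp, h⟩
          rwa [show p = φ.pos hβ l.1 from Fin.ext hp] at h
        rw [e7]
        exact ⟨fun h _ h' => h ⟨e6, h'⟩, fun h h' => h ht h'.2⟩
      · rw [hlen]
        constructor
        · intro h _ l hl
          obtain ⟨t, ht, rfl⟩ := List.getElem_of_mem hl
          by_contra hno
          exact h ⟨t, ht, fun _ => hno⟩
        · rintro h ⟨t, ht, hno⟩
          exact hno ht (h hc _ (List.getElem_mem ht))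
    · rintro ⟨c, hc, h⟩
      exact ⟨_, List.getElem_mem hc, h hc⟩
    · rintro ⟨c, hc, h⟩
      obtain ⟨i, hi, rfl⟩ := List.getElem_of_mem hc
      exact ⟨i, hi, fun _ => h⟩

end RAM.Expr

/-! ### The graph of a formula -/

namespace QSAT

variable {q : ℕ} (φ : QSAT q) {β γ h : ℕ} (κ : BlockCode β γ h) (hβ : 0 < β)

variable (β γ) in
/-- The numbering of the vertices of the graph, with the elements first. -/
def number : (Fin (φ.blocks β) × Fin γ) ⊕ Fin (φ.indices β γ) × (Fin (φ.blocks β) × Fin γ) ≃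
    Fin (φ.vertices β γ) :=
  (Equiv.sumCongr finProdFinEquiv
    ((Equiv.prodCongr (Equiv.refl _) finProdFinEquiv).trans finProdFinEquiv)).trans finSumFinEquiv

theorem number_inl (v : Fin (φ.blocks β) × Fin γ) :
    (φ.number β γ (.inl v)).1 = (finProdFinEquiv v).1 := rfl

theorem number_inr (s : Fin (φ.indices β γ)) (v : Fin (φ.blocks β) × Fin γ) :
    (φ.number β γ (.inr (s, v))).1 =
      φ.elements β γ + ((finProdFinEquiv v).1 + φ.elements β γ * s.1) := rfl

/-- The graph of a formula, which expresses that certain sets have to be hit. -/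
def graph : SimpleGraph (Fin (φ.vertices β γ)) :=
  (hittingGraph (fun s : Fin (φ.indices β γ) =>
      κ.Required φ (φ.blk β) (φ.pos hβ) (blockMask γ (φ.blocks β) q) s)
    fun s => {v | v.2 ∈ blockMask γ (φ.blocks β) q s v.1}).comap
    (φ.number β γ).symm

variable (β γ) in
/-- The vertices that stand for the elements. -/
def modulator : Finset (Fin (φ.vertices β γ)) := {a | a.1 < φ.elements β γ}

variable (h β γ) in
/-- The size of the vertex covers that stand for satisfying assignments. -/
def coverSize : ℕ := h * φ.blocks β + φ.indices β γ * (φ.elements β γ - 1)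

theorem card_modulator : (φ.modulator β γ).card = φ.elements β γ := by
  rw [modulator, Fin.card_filter_val_lt]
  exact min_eq_right (Nat.le_add_right _ _)

/-- Without the elements, the graph is a disjoint union of cliques. -/
theorem isCVD_modulator : IsCVD (φ.graph κ hβ) (φ.modulator β γ : Set _) := by
  refine isChordal_of_trans ?_
  rintro ⟨a, ha⟩ ⟨b, hb⟩ ⟨c, hc⟩ hab hbc hac
  obtain ⟨u, rfl⟩ := (φ.number β γ).surjective a
  obtain ⟨v, rfl⟩ := (φ.number β γ).surjective b
  obtain ⟨w, rfl⟩ := (φ.number β γ).surjective c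
  simp only [graph, SimpleGraph.comap_adj, Function.Embedding.subtype_apply,
    Equiv.symm_apply_apply] at hab hbc ⊢
  have key : ∀ v, φ.number β γ (.inl v) ∈ φ.modulator β γ := by
    intro v
    simp only [modulator, Finset.mem_filter, Finset.mem_univ, true_and, number_inl]
    exact (finProdFinEquiv v).2
  rcases u with u | ⟨s, u⟩
  · exact absurd (key u) ha
  rcases v with v | ⟨s', v⟩
  · exact absurd (key v) hb
  rcases w with w | ⟨s'', w⟩
  · exact absurd (key w) hc
  refine ⟨hab.1.trans hbc.1, ?_⟩
  rintro rfl
  exact hac (by rw [Subtype.mk.injEq, hab.1, hbc.1])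

/-- The graph has a vertex cover of the given size if and only if the formula is satisfiable. -/
theorem hasVertexCover_iff (hq : 0 < q) (hγ : h < γ) :
    HasVertexCover (φ.graph κ hβ) (φ.coverSize β γ h) ↔ φ.Satisfiable := by
  let e := φ.number β γ
  have hL : 0 < φ.blocks β := Nat.succ_pos _
  have hγ' : 0 < γ := by omega
  have : Nonempty (Fin (φ.blocks β) × Fin γ) := ⟨⟨⟨0, hL⟩, ⟨0, hγ'⟩⟩⟩
  have hcardV : Fintype.card (Fin (φ.blocks β) × Fin γ) = φ.elements β γ := by
    simp [elements]
  constructor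
  · rintro ⟨C, hC, hcov⟩
    obtain ⟨A, hA, hit⟩ := hittingGraph.exists_hitting (t := h * φ.blocks β)
      (req := fun s : Fin (φ.indices β γ) =>
        κ.Required φ (φ.blk β) (φ.pos hβ) (blockMask γ (φ.blocks β) q) s)
      (M := fun s => {v : _ × Fin γ | v.2 ∈ blockMask γ (φ.blocks β) q s v.1})
      (C := C.map e.symm.toEmbedding) (fun u v huv => by
        have := hcov (v := e u) (w := e v) (by simpa [graph, e] using huv)
        simpa using this) (by
        rw [Finset.card_map, hC, hcardV, Fintype.card_fin]; rfl)
    exact κ.satisfiable hq hL hγ (mask := fun s : Fin (φ.indices β γ) =>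
      blockMask γ (φ.blocks β) q s) (fun N j => exists_blockMask N j) hA hit
  · intro hφ
    obtain ⟨A, hA, hit⟩ := κ.exists_hitting (mask := fun s : Fin (φ.indices β γ) =>
      blockMask γ (φ.blocks β) q s) (φ.blk_pos_injective β hβ) hφ
    obtain ⟨C, hcov, hC⟩ := hittingGraph.exists_cover (req := fun s : Fin (φ.indices β γ) =>
        κ.Required φ (φ.blk β) (φ.pos hβ) (blockMask γ (φ.blocks β) q) s)
      (M := fun s => {v : _ × Fin γ | v.2 ∈ blockMask γ (φ.blocks β) q s v.1}) A
      fun s hs => hit s hs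
    refine ⟨C.map e.toEmbedding, ?_, fun a b hab => ?_⟩
    · rw [Finset.card_map, hC, hA, hcardV, Fintype.card_fin]; rfl
    · have := hcov hab
      simpa [e] using this

/-- Adjacency in terms of the numbers `a < b` of two vertices. -/
def AdjNum (a b : ℕ) : Prop :=
  φ.elements β γ ≤ b ∧
    ((a < φ.elements β γ ∧
        κ.Required φ (φ.blk β) (φ.pos hβ) (blockMask γ (φ.blocks β) q)
          ((b - φ.elements β γ) / φ.elements β γ) ∧
        (a = (b - φ.elements β γ) % φ.elements β γ ∨
          ¬ ∃ p : Fin γ, p.1 = (b - φ.elements β γ) % φ.elements β γ % γ ∧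
            p ∈ blockSet γ (maskNumber (2 ^ γ) (φ.blocks β * 2 ^ γ)
              ((b - φ.elements β γ) / φ.elements β γ)
              ((b - φ.elements β γ) % φ.elements β γ / γ) q))) ∨
      (φ.elements β γ ≤ a ∧ (a - φ.elements β γ) / φ.elements β γ =
        (b - φ.elements β γ) / φ.elements β γ))

theorem graph_adj_of_lt {a b : Fin (φ.vertices β γ)} (hab : a < b) :
    (φ.graph κ hβ).Adj a b ↔ φ.AdjNum κ hβ a b := by
  obtain ⟨u, rfl⟩ := (φ.number β γ).surjective a
  obtain ⟨v, rfl⟩ := (φ.number β γ).surjective b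
  rw [AdjNum, graph, SimpleGraph.comap_adj, Equiv.symm_apply_apply, Equiv.symm_apply_apply]
  have hlt : ∀ v : Fin (φ.blocks β) × Fin γ, (finProdFinEquiv v).1 < φ.elements β γ :=
    fun v => (finProdFinEquiv v).2
  have hdiv : ∀ s v, ((finProdFinEquiv v).1 + φ.elements β γ * s) / φ.elements β γ = s :=
    fun s v => by
      rw [Nat.add_mul_div_left _ _ (by have := hlt v; omega), Nat.div_eq_of_lt (hlt v), zero_add]
  have hmod : ∀ s v, ((finProdFinEquiv v).1 + φ.elements β γ * s) % φ.elements β γ =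
      (finProdFinEquiv v).1 := fun s v => by
    rw [Nat.add_mul_mod_self_left, Nat.mod_eq_of_lt (hlt v)]
  have hlt' : ∀ u v : Fin (φ.blocks β) × Fin γ, (finProdFinEquiv u).1 = (finProdFinEquiv v).1 →
      u = v := fun u v huv => finProdFinEquiv.injective (Fin.ext huv)
  rw [Fin.lt_def] at hab
  rcases u with u | ⟨s, u⟩ <;> rcases v with v | ⟨s', v⟩
  · rw [number_inl, number_inl]
    exact ⟨fun h => h.elim, fun h => absurd h.1 (by have := hlt v; omega)⟩
  · rw [number_inl, number_inr, Nat.add_sub_cancel_left, hdiv, hmod]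
    have hp : ∀ s, (∃ p : Fin γ, p.1 = (finProdFinEquiv v).1 % γ ∧
        p ∈ blockSet γ (maskNumber (2 ^ γ) (φ.blocks β * 2 ^ γ) s
          ((finProdFinEquiv v).1 / γ) q)) ↔ v.2 ∈ blockMask γ (φ.blocks β) q s v.1 := by
      intro s
      have hγ : 0 < γ := v.2.pos
      have h1 : (finProdFinEquiv v).1 % γ = v.2 := by
        change (v.2.1 + γ * v.1.1) % γ = v.2
        rw [Nat.add_mul_mod_self_left, Nat.mod_eq_of_lt v.2.2]
      have h2 : (finProdFinEquiv v).1 / γ = v.1 := by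
        change (v.2.1 + γ * v.1.1) / γ = v.1
        rw [Nat.add_mul_div_left _ _ hγ, Nat.div_eq_of_lt v.2.2, zero_add]
      rw [h1, h2]
      refine ⟨?_, fun h => ⟨_, rfl, h⟩⟩
      rintro ⟨p, hp, h⟩
      rwa [Fin.ext hp] at h
    rw [hp]
    constructor
    · rintro ⟨h1, h2⟩
      exact ⟨Nat.le_add_right _ _, .inl ⟨hlt u, h1, h2.imp_left (by rintro rfl; rfl)⟩⟩
    · rintro ⟨-, ⟨-, h1, h2⟩ | ⟨h1, -⟩⟩
      · exact ⟨h1, h2.imp_left (hlt' _ _)⟩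
      · have := hlt u
        omega
  · rw [number_inl, number_inr] at hab
    have := hlt v
    omega
  · rw [number_inr, number_inr] at hab ⊢
    rw [Nat.add_sub_cancel_left, Nat.add_sub_cancel_left, hdiv, hdiv]
    constructor
    · rintro ⟨rfl, -⟩
      exact ⟨Nat.le_add_right _ _, .inr ⟨Nat.le_add_right _ _, rfl⟩⟩
    · rintro ⟨-, ⟨h1, -⟩ | ⟨-, h1⟩⟩
      · omega
      · refine ⟨Fin.ext h1, ?_⟩
        rintro rfl
        rw [h1] at hab
        omega

theorem graph_adj (a b : Fin (φ.vertices β γ)) :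
    (φ.graph κ hβ).Adj a b ↔ a.1 ≠ b.1 ∧ φ.AdjNum κ hβ (min a.1 b.1) (max a.1 b.1) := by
  rcases lt_trichotomy a b with h | rfl | h
  · rw [graph_adj_of_lt _ _ _ h, min_eq_left (Fin.lt_def.1 h).le,
      max_eq_right (Fin.lt_def.1 h).le]
    exact (and_iff_right (Fin.val_ne_of_ne h.ne)).symm
  · simp
  · rw [SimpleGraph.adj_comm, graph_adj_of_lt _ _ _ h, min_eq_right (Fin.lt_def.1 h).le,
      max_eq_left (Fin.lt_def.1 h).le]
    exact (and_iff_right (Fin.val_ne_of_ne h.ne')).symm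

end QSAT

/-! ### The encoding of the graph as a list of values of an expression -/

/-- A matrix that is listed row by row. -/
theorem List.flatMap_range_map {α : Type} (f : ℕ → ℕ → α) (m n : ℕ) :
    (List.range m).flatMap (fun i => (List.range n).map (f i)) =
      (List.range (m * n)).map fun k => f (k / n) (k % n) := by
  induction m with
  | zero => simp
  | succ m ih =>
    rw [List.range_succ, List.flatMap_append, ih, add_mul, one_mul, List.range_add,
      List.map_append]
    congr 1
    simp only [List.flatMap_cons, List.flatMap_nil, List.append_nil, List.map_map]
    refine List.map_congr_left fun k hk => ?_
    have hk' : k < n := List.mem_range.1 hk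
    simp only [Function.comp]
    rw [mul_comm, Nat.mul_add_div (by omega), Nat.div_eq_of_lt hk', Nat.mul_add_mod,
      Nat.mod_eq_of_lt hk', add_zero]

theorem List.finRange_map {α : Type} (n : ℕ) (f : ℕ → α) :
    ((List.finRange n).map fun i : Fin n => f i) = (List.range n).map f := by
  rw [← List.map_coe_finRange_eq_range (n := n), List.map_map]; rfl

open Classical in
theorem encodeGraph_eq {n : ℕ} (G : SimpleGraph (Fin n)) (k l : ℕ) (R : ℕ → ℕ → Prop)
    (hR : ∀ a b : Fin n, G.Adj a b ↔ R a b) :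
    encodeGraph G k l = n :: k :: l ::
      (List.range (n * n)).map fun t => if R (t / n) (t % n) then 1 else 0 := by
  rw [encodeGraph, ← List.flatMap_range_map fun i j => if R i j then 1 else 0,
    ← List.map_coe_finRange_eq_range, List.flatMap_map]
  congr 4
  funext i
  rw [List.map_map]
  refine List.map_congr_left fun j _ => ?_
  simp only [Function.comp, hR]

namespace RAM.Expr

variable {β γ h : ℕ} (κ : BlockCode β γ h) (q : ℕ)

/-- The expression for `QSAT.AdjNum`. The variables `1` and `2` are the greater and the smaller
number of a vertex, and variable `0` is the index of the set that the former belongs to. -/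
noncomputable def adjNumE : Expr :=
  mul (le (elementsE β γ) (var 1))
    (or (mul (not (le (elementsE β γ) (var 2))) (mul (requiredE κ q 0)
        (or (eq (var 2) (mod (sub (var 1) (elementsE β γ)) (elementsE β γ)))
          (not (table (fun k => ∃ p : Fin γ, p.1 = k % γ ∧ p ∈ blockSet γ (k / γ))
            ((2 ^ γ + 1) * γ)
            (add (mul (maskE β γ (var 0) (div (mod (sub (var 1) (elementsE β γ)) (elementsE β γ))
                (const γ)) q) (const γ))
              (mod (mod (sub (var 1) (elementsE β γ)) (elementsE β γ)) (const γ))))))))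
      (mul (le (elementsE β γ) (var 2))
        (eq (div (sub (var 2) (elementsE β γ)) (elementsE β γ)) (var 0))))

theorem decides_adjNumE {φ : QSAT q} (hβ : 0 < β) (hγ : 0 < γ) (env : ℕ → ℕ) (a b : ℕ) :
    (adjNumE κ q).Decides φ.encode (push ((b - φ.elements β γ) / φ.elements β γ)
      (push b (push a env))) (φ.AdjNum κ hβ a b) := by
  set env' := push ((b - φ.elements β γ) / φ.elements β γ) (push b (push a env)) with henv
  have e0 : env' 0 = (b - φ.elements β γ) / φ.elements β γ := rfl
  have e1 : env' 1 = b := rfl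
  have e2 : env' 2 = a := rfl
  refine Decides.and ?_ (Decides.or (Decides.and ?_ (Decides.and ?_ (Decides.or ?_
    (Decides.not ?_)))) (Decides.and ?_ ?_))
  · exact decides_le _ _ _ _
  · exact (decides_le _ _ _ _).not.congr not_le
  · exact decides_requiredE κ hβ _ 0
  · exact (decides_eq _ _ _ _).congr (by simp only [eval, eval_mod, eval_elementsE, e1, e2])
  · refine (decides_table _ _ _ _ _).congr ?_
    simp only [eval, eval_mod, eval_maskE, eval_elementsE, e0, e1]
    set i := (b - φ.elements β γ) % φ.elements β γ
    set μ := maskNumber (2 ^ γ) (φ.blocks β * 2 ^ γ) ((b - φ.elements β γ) / φ.elements β γ)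
      (i / γ) q
    have hμ : μ ≤ 2 ^ γ := maskNumber_le (Nat.two_pow_pos γ) _ _ _ _
    have hi := Nat.mod_lt i hγ
    have h1 : (μ * γ + i % γ) / γ = μ := by
      rw [mul_comm, Nat.mul_add_div hγ, Nat.div_eq_of_lt hi, add_zero]
    have h2 : (μ * γ + i % γ) % γ = i % γ := by
      rw [mul_comm, Nat.mul_add_mod, Nat.mod_mod]
    rw [h1, h2]
    refine and_iff_right ?_
    calc _ < (μ + 1) * γ := by rw [add_mul]; omega
      _ ≤ _ := Nat.mul_le_mul_right _ (by omega)
  · exact decides_le _ _ _ _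
  · exact decides_eq _ _ _ _

/-- Adjacency of the vertices whose numbers are the variables `1` and `0`. -/
noncomputable def adjE : Expr :=
  mul (not (eq (var 1) (var 0)))
    (bind (sub (var 1) (sub (var 1) (var 0))) (bind (add (var 1) (sub (var 2) (var 1)))
      (bind (div (sub (var 0) (elementsE β γ)) (elementsE β γ)) (adjNumE κ q))))

theorem decides_adjE {φ : QSAT q} (hβ : 0 < β) (hγ : 0 < γ) (env : ℕ → ℕ) (a b : ℕ) :
    (adjE κ q).Decides φ.encode (push b (push a env))
      (a ≠ b ∧ φ.AdjNum κ hβ (min a b) (max a b)) := by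
  refine Decides.and ((decides_eq _ _ _ _).not.congr (by rfl)) ?_
  have h1 : a - (a - b) = min a b := by omega
  have h2 : b + (a - b) = max a b := by omega
  unfold Decides
  simp only [eval, eval_elementsE, push_zero, push_succ, h1, h2]
  exact decides_adjNumE κ q hβ hγ _ _ _

/-- The length of the encoding of the graph, together with a characteristic vector if `given`. -/
def lengthE (β γ q : ℕ) (given : Bool) : Expr :=
  add (add (const 3) (mul (verticesE q β γ) (verticesE q β γ)))
    (if given then verticesE q β γ else const 0)

/-- The entries of the encoding of the graph and of the characteristic vector of the modulator, as
a function of the position, which is variable `0`. -/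
noncomputable def entryE : Expr :=
  ite (eq (var 0) (const 0)) (verticesE q β γ)
    (ite (eq (var 0) (const 1)) (elementsE β γ)
      (ite (eq (var 0) (const 2))
        (add (mul (const h) (blocksE β))
          (mul (indicesE q β γ) (sub (elementsE β γ) (const 1))))
        (ite (le (add (const 3) (mul (verticesE q β γ) (verticesE q β γ))) (var 0))
          (not (le (elementsE β γ)
            (sub (var 0) (add (const 3) (mul (verticesE q β γ) (verticesE q β γ))))))
          (bind (div (sub (var 0) (const 3)) (verticesE q β γ))
            (bind (mod (sub (var 1) (const 3)) (verticesE q β γ)) (adjE κ q))))))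

open Classical in
/-- The reduction, given by expressions, produces the encoding of the graph instance. -/
theorem listOf_lengthE_entryE {φ : QSAT q} (hβ : 0 < β) (hγ : 0 < γ) (given : Bool) :
    listOf (lengthE β γ q given) (entryE κ q) φ.encode =
      encodeGraph (φ.graph κ hβ) (φ.elements β γ) (φ.coverSize β γ h) ++
        if given then (List.finRange (φ.vertices β γ)).map
          (fun i => if i ∈ φ.modulator β γ then 1 else 0) else [] := by
  obtain ⟨R, hR⟩ : ∃ R : ℕ → ℕ → Prop, ∀ a b,
      R a b ↔ a ≠ b ∧ φ.AdjNum κ hβ (min a b) (max a b) := ⟨_, fun _ _ => Iff.rfl⟩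
  rw [encodeGraph_eq _ _ _ R fun a b => (φ.graph_adj κ hβ a b).trans (hR _ _).symm]
  set n := φ.vertices β γ with hn
  have hent : ∀ i, (entryE κ q).eval φ.encode (fun _ => i) =
      if i = 0 then n else if i = 1 then φ.elements β γ else if i = 2 then φ.coverSize β γ h else
      if 3 + n * n ≤ i then if i - (3 + n * n) < φ.elements β γ then 1 else 0 else
      if R ((i - 3) / n) ((i - 3) % n) then 1 else 0 := by
    intro i
    rw [entryE, (decides_eq _ _ _ _).eval_ite, (decides_eq _ _ _ _).eval_ite,
      (decides_eq _ _ _ _).eval_ite, (decides_le _ _ _ _).eval_ite]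
    congr 1
    · rw [eval_verticesE]
    congr 1
    congr 1
    · simp only [eval, eval_indicesE, eval_elementsE, eval_blocksE]; rfl
    have h3 : (add (const 3) (mul (verticesE q β γ) (verticesE q β γ))).eval φ.encode
        (fun _ => i) = 3 + n * n := by
      simp only [eval, eval_verticesE, hn]
    rw [h3]
    congr 1
    · have := ((decides_le φ.encode (fun _ => i) (elementsE β γ)
        (sub (var 0) (add (const 3) (mul (verticesE q β γ) (verticesE q β γ))))).not)
      rw [eval_elementsE, eval, h3] at this
      split_ifs with h'
      · exact this.1 (not_le.2 h')
      · exact this.2 fun h'' => h' (not_le.1 h'')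
    · have := (decides_adjE κ q (φ := φ) hβ hγ (fun _ => i) ((i - 3) / n) ((i - 3) % n)).congr
        (hR _ _).symm
      simp only [eval, eval_mod, eval_verticesE, push_one, ← hn]
      split_ifs with h'
      · exact this.1 h'
      · exact this.2 h'
  have hlen : (lengthE β γ q given).eval φ.encode (fun _ => φ.encode.length) =
      3 + (n * n + if given then n else 0) := by
    rw [lengthE]
    cases given <;> simp [eval, eval_verticesE, hn, add_assoc]
  rw [listOf, hlen, List.range_add, List.range_add, List.map_append, List.map_append,
    List.map_append, List.map_map, List.map_map, List.map_map]
  have h3 : (List.range 3).map (fun i => (entryE κ q).eval φ.encode fun _ => i) =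
      [n, φ.elements β γ, φ.coverSize β γ h] := by
    simp [List.range_succ, hent]
  have hadj : (List.range (n * n)).map
      ((fun i => (entryE κ q).eval φ.encode fun _ => i) ∘ fun i => 3 + i) =
      (List.range (n * n)).map fun t => if R (t / n) (t % n) then 1 else 0 := by
    refine List.map_congr_left fun i hi => ?_
    have hi' := List.mem_range.1 hi
    have h0 : 3 + i ≠ 0 := by omega
    have h1 : 3 + i ≠ 1 := by omega
    have h2 : 3 + i ≠ 2 := by omega
    have h4 : ¬ 3 + n * n ≤ 3 + i := by omega
    simp only [Function.comp, hent, h0, h1, h2, h4, if_false, Nat.add_sub_cancel_left]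
  have hmod : (List.range (if given then n else 0)).map
      (((fun i => (entryE κ q).eval φ.encode fun _ => i) ∘ fun i => 3 + i) ∘ fun i => n * n + i) =
      if given then (List.finRange n).map
        (fun i => if i ∈ φ.modulator β γ then 1 else 0) else [] := by
    cases given
    · rfl
    · have : (List.finRange n).map (fun i => if i ∈ φ.modulator β γ then 1 else 0) =
          (List.range n).map fun i => if i < φ.elements β γ then 1 else 0 := by
        rw [← List.finRange_map]
        refine List.map_congr_left fun i _ => ?_
        simp [QSAT.modulator]
      rw [if_pos rfl, if_pos rfl, this]
      refine List.map_congr_left fun i hi => ?_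
      have h0 : 3 + (n * n + i) ≠ 0 := by omega
      have h1 : 3 + (n * n + i) ≠ 1 := by omega
      have h2 : 3 + (n * n + i) ≠ 2 := by omega
      have h4 : 3 + n * n ≤ 3 + (n * n + i) := by omega
      have h5 : 3 + (n * n + i) - (3 + n * n) = i := by omega
      simp only [Function.comp, hent, h0, h1, h2, h4, h5, if_false, if_true]
  rw [h3, hadj, hmod]
  rfl

end RAM.Expr

/-! ### Running times -/

theorem RAM.Exec.eq_of_cost_eq_zero {p : Prog} {s s' : State} {t : ℕ} (e : Exec p s t s')
    (ht : t = 0) : s' = s := by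
  induction e with
  | skip => rfl
  | instr i s => cases i <;> simp [Instr.cost] at ht
  | seq _ _ ih₁ ih₂ => rw [ih₂ (by omega), ih₁ (by omega)]
  | ite_true | ite_false | loop_step => omega
  | loop_done => rfl

theorem RAM.inputSize_le {y : List ℕ} {A : ℕ} (hlen : y.length ≤ A) (hy : ∀ a ∈ y, a ≤ A) :
    inputSize y ≤ A * (A + 1) := by
  calc inputSize y ≤ (y.map fun a => a.size + 1).length • (A + 1) :=
        List.sum_le_card_nsmul _ _ fun b hb => by
          obtain ⟨a, ha, rfl⟩ := List.mem_map.1 hb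
          have := RAM.size_le_self a
          have := hy a ha
          omega
    _ ≤ A * (A + 1) := by
      rw [List.length_map, smul_eq_mul]
      exact Nat.mul_le_mul_right _ hlen

/-- Powers of linear functions are absorbed by exponential functions. -/
theorem exists_pow_le_mul_two_rpow (A D : ℕ) {δ : ℝ} (hδ : 0 < δ) :
    ∃ C : ℝ, 0 ≤ C ∧ ∀ n : ℕ, (2 * (n : ℝ) + A) ^ D ≤ C * 2 ^ (δ * n) := by
  have hr : (1 : ℝ) < 2 ^ δ := Real.one_lt_rpow (by norm_num) hδ
  have hr0 : (0 : ℝ) < 2 ^ δ := by linarith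
  obtain ⟨C, hC, hb⟩ := Asymptotics.bound_of_isBigO_nat_atTop
    (isLittleO_pow_const_const_pow_of_one_lt (R := ℝ) D hr).isBigO
  refine ⟨(A + 2) ^ D * C * 2 ^ δ, by positivity, fun n => ?_⟩
  have h1 := @hb (n + 1) (by positivity)
  rw [Real.norm_of_nonneg (by positivity), Real.norm_of_nonneg (by positivity)] at h1
  push_cast at h1
  have h2 : (2 * (n : ℝ) + A) ≤ (A + 2) * (n + 1) := by
    have : (0 : ℝ) ≤ A * n := by positivity
    linarith
  calc (2 * (n : ℝ) + A) ^ D ≤ ((A + 2) * (n + 1)) ^ D := by gcongr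
    _ = (A + 2) ^ D * (n + 1) ^ D := mul_pow _ _ _
    _ ≤ (A + 2) ^ D * (C * (2 ^ δ) ^ (n + 1)) := by gcongr
    _ = (A + 2) ^ D * C * 2 ^ δ * 2 ^ (δ * n) := by
      rw [pow_succ, Real.rpow_mul_natCast (by norm_num)]; ring

/-- Block lengths for which the encoding of assignments by sets costs only little: with
`γ = 2 ^ a` and `β = 2 ^ a - a`, the quotient `γ / β` tends to `1`. -/
theorem exists_block_sizes {b c : ℝ} (hb : 1 ≤ b) (hc : Real.logb 2 b < c) :
    ∃ β γ h : ℕ, 0 < β ∧ h < γ ∧ 2 ^ β ≤ γ.choose h ∧ b ^ γ ≤ 2 ^ (c * β) := by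
  set l := Real.logb 2 b with hl
  have hl0 : 0 ≤ l := Real.logb_nonneg (by norm_num) hb
  have hlo := isLittleO_pow_const_const_pow_of_one_lt (R := ℝ) 1 (show (1 : ℝ) < 2 by norm_num)
  have hε : 0 < (c - l) / c := div_pos (by linarith) (by linarith)
  obtain ⟨a, ha, ha1⟩ := ((hlo.bound hε).and (Filter.eventually_ge_atTop 1)).exists
  rw [Real.norm_of_nonneg (by positivity), Real.norm_of_nonneg (by positivity), pow_one,
    div_mul_eq_mul_div, le_div_iff₀ (by linarith)] at ha
  obtain ⟨a, rfl⟩ : ∃ k, a = k + 1 := ⟨a - 1, by omega⟩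
  have hlt : a + 1 < 2 ^ (a + 1) := Nat.lt_two_pow_self
  have h2 : 2 ^ (a + 1) = 2 * 2 ^ a := pow_succ' _ _
  have hpos : 0 < 2 ^ a := Nat.two_pow_pos a
  refine ⟨2 ^ (a + 1) - (a + 1), 2 ^ (a + 1), 2 ^ a, by omega, by omega, ?_, ?_⟩
  · have h4 := Nat.four_pow_le_two_mul_self_mul_centralBinom (2 ^ a) hpos
    have e4 : 4 ^ 2 ^ a = 2 ^ (a + 1) * 2 ^ (2 ^ (a + 1) - (a + 1)) := by
      rw [← pow_add, show a + 1 + (2 ^ (a + 1) - (a + 1)) = 2 * 2 ^ a by omega, pow_mul]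
      norm_num
    rw [e4, ← h2] at h4
    have := Nat.le_of_mul_le_mul_left h4 (Nat.two_pow_pos _)
    rwa [Nat.centralBinom_eq_two_mul_choose, ← h2] at this
  · have hb' : b = 2 ^ l := (Real.rpow_logb (by norm_num) (by norm_num) (by linarith)).symm
    rw [hb', ← Real.rpow_mul_natCast (by norm_num)]
    apply Real.rpow_le_rpow_of_exponent_le (by norm_num)
    rw [Nat.cast_sub hlt.le]
    push_cast at ha ⊢
    linarith

/-- A program that answers the graph instances within time `b ^ k` yields an algorithm for
`q`-SAT. -/
theorem qsatSolvable_of_graph {q β γ h : ℕ} (κ : BlockCode β γ h) {b c₁ c : ℝ}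
    (hb : 1 ≤ b) (hc₁ : 0 ≤ c₁) (hc : c₁ < c) (hbγ : b ^ γ ≤ 2 ^ (c₁ * β)) (given : Bool)
    (p : RAM.Prog) (C d : ℕ)
    (hp : ∀ φ : QSAT q, ∃ (t : ℕ) (s : RAM.State),
      RAM.Exec p (RAM.input (RAM.listOf (RAM.Expr.lengthE β γ q given) (RAM.Expr.entryE κ q)
        φ.encode)) t s ∧
      (t : ℝ) ≤ C * b ^ φ.elements β γ * (RAM.inputSize (RAM.listOf
        (RAM.Expr.lengthE β γ q given) (RAM.Expr.entryE κ q) φ.encode) : ℝ) ^ d ∧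
      (s.reg 0 = 1 ↔ φ.Satisfiable)) : QSATSolvable q c := by
  obtain ⟨r, F, pF, hr⟩ := RAM.exists_reduction p (RAM.Expr.lengthE β γ q given)
    (RAM.Expr.entryE κ q)
  have one := RAM.PolyBdd.const 1
  obtain ⟨D, hD⟩ := (pF.mul (one.add ((pF.mul (pF.add one)).pow d))).2
  obtain ⟨C₂, hC₂, hexp⟩ := exists_pow_le_mul_two_rpow (q + 4) D (sub_pos.2 hc)
  have hb0 : 0 < b := by linarith
  refine ⟨r, ⌈(1 + C) * b ^ γ * C₂⌉₊, D, fun φ => ?_⟩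
  set n := φ.n
  set m := φ.clauses.length
  set X := (2 * n + (q + 4)) * (m + 1) with hX
  have hX2 : X = 2 * (n * m) + m * q + 4 * m + (2 * n + q + 4) := by rw [hX]; ring
  have hlen : φ.encode.length ≤ X := by
    have h1 : φ.offset m ≤ m * (q + 1) := φ.offset_le le_rfl
    rw [mul_add, mul_one] at h1
    rw [φ.length_encode]
    change 2 + φ.offset m ≤ X
    omega
  have hle : ∀ a ∈ φ.encode, a ≤ X := fun a ha => by
    have h1 : a ≤ 2 * n + m + q := φ.le_of_mem_encode ha
    omega
  obtain ⟨⟨hy, hy'⟩, hrun⟩ := hr X φ.encode (by omega) hlen hle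
  obtain ⟨t, s, e, ht, hs⟩ := hp φ
  obtain ⟨u, ⟨T, hT, e'⟩, hu⟩ := hrun t s e
  refine ⟨T, u, e', ?_, by rw [hu, hs]⟩
  have hsize := RAM.inputSize_le hy hy'
  have hbK : (1 : ℝ) ≤ b ^ φ.elements β γ := one_le_pow₀ hb
  have hbK' : b ^ φ.elements β γ ≤ b ^ γ * 2 ^ (c₁ * n) := by
    rw [QSAT.elements, QSAT.blocks, add_mul, one_mul, pow_add, mul_comm, mul_comm _ γ, pow_mul]
    gcongr
    calc (b ^ γ) ^ (φ.n / β) ≤ (2 ^ (c₁ * β)) ^ (φ.n / β) := by gcongr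
      _ = (2 : ℝ) ^ (c₁ * β * (φ.n / β : ℕ)) := (Real.rpow_mul_natCast (by norm_num) _ _).symm
      _ ≤ 2 ^ (c₁ * n) := by
        apply Real.rpow_le_rpow_of_exponent_le (by norm_num)
        rw [mul_assoc]
        gcongr
        exact_mod_cast Nat.mul_div_le φ.n β
  have hFD : (F X : ℝ) * (1 + ((F X : ℝ) * (F X + 1)) ^ d) ≤ (X : ℝ) ^ D := by
    exact_mod_cast hD X (by omega)
  have hX' : (X : ℝ) ^ D ≤ C₂ * 2 ^ ((c - c₁) * n) * ((m : ℝ) + 1) ^ D := by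
    rw [hX]
    push_cast
    rw [mul_pow]
    gcongr
    exact_mod_cast hexp n
  have ht' : (t : ℝ) ≤ C * b ^ φ.elements β γ * ((F X : ℝ) * (F X + 1)) ^ d := by
    refine ht.trans ?_
    gcongr
    exact_mod_cast hsize
  calc (T : ℝ) ≤ F X + F X * t := by exact_mod_cast hT
    _ ≤ F X + F X * (C * b ^ φ.elements β γ * ((F X : ℝ) * (F X + 1)) ^ d) := by gcongr
    _ ≤ (1 + C) * b ^ φ.elements β γ *
        ((F X : ℝ) * (1 + ((F X : ℝ) * (F X + 1)) ^ d)) := by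
      have h0 : (0 : ℝ) ≤ F X := Nat.cast_nonneg _
      have h1 : (0 : ℝ) ≤ ((F X : ℝ) * (F X + 1)) ^ d := by positivity
      have h2 : (0 : ℝ) ≤ C := Nat.cast_nonneg _
      have h3 : (F X : ℝ) ≤ b ^ φ.elements β γ * F X := le_mul_of_one_le_left h0 hbK
      have h4 : 0 ≤ b ^ φ.elements β γ * (F X * ((F X : ℝ) * (F X + 1)) ^ d) := by positivity
      have h5 : 0 ≤ C * (b ^ φ.elements β γ * F X) := by positivity
      linarith
    _ ≤ (1 + C) * (b ^ γ * 2 ^ (c₁ * n)) * (C₂ * 2 ^ ((c - c₁) * n) * ((m : ℝ) + 1) ^ D) := by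
      exact mul_le_mul (by gcongr) (hFD.trans hX') (by positivity) (by positivity)
    _ = (1 + C) * b ^ γ * C₂ * 2 ^ (c * n) * ((m : ℝ) + 1) ^ D := by
      rw [show c * (n : ℝ) = c₁ * n + (c - c₁) * n by ring, Real.rpow_add (by norm_num)]
      ring
    _ ≤ ⌈(1 + C) * b ^ γ * C₂⌉₊ * 2 ^ (c * n) * ((m : ℝ) + 1) ^ D := by
      gcongr
      exact Nat.le_ceil _

/-! ### The lower bound -/

/-- For `b ≤ 0` the bound `b ^ k` is not monotone in `b`, but for `k = 1` it leaves no time for even a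
single instruction, and the initial state does not answer "yes". -/
theorem not_vcByCVDSolvable_of_nonpos {b : ℝ} (hb : b ≤ 0) : ¬ VCByCVDSolvable b := by
  rintro ⟨p, C, d, hp⟩
  have hS : IsCVD (⊥ : SimpleGraph (Fin 1)) (({0} : Finset (Fin 1)) : Set (Fin 1)) :=
    isChordal_of_trans fun _ _ _ h => h.elim
  obtain ⟨t, s, e, ht, hs⟩ := hp ⟨1, ⊥, 1, 0, {0}, rfl, hS⟩
  have h0 : (t : ℝ) ≤ 0 := ht.trans <| mul_nonpos_of_nonpos_of_nonneg
    (mul_nonpos_of_nonneg_of_nonpos (Nat.cast_nonneg _) (by simpa using hb)) (by positivity)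
  rw [e.eq_of_cost_eq_zero (by exact_mod_cast h0.antisymm (Nat.cast_nonneg t))] at hs
  have := hs.2 ⟨∅, rfl, fun _ _ h => h.elim⟩
  simp [RAM.input, VCByCVD.encode, encodeGraph] at this

/-- The analogue of `not_vcByCVDSolvable_of_nonpos` for a given set. -/
theorem not_vcByGivenCVDSolvable_of_nonpos {b : ℝ} (hb : b ≤ 0) : ¬ VCByGivenCVDSolvable b := by
  rintro ⟨p, C, d, hp⟩
  have hS : IsCVD (⊥ : SimpleGraph (Fin 1)) (({0} : Finset (Fin 1)) : Set (Fin 1)) :=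
    isChordal_of_trans fun _ _ _ h => h.elim
  obtain ⟨t, s, e, ht, hs⟩ := hp ⟨1, ⊥, 1, 0, {0}, rfl, hS⟩
  have h0 : (t : ℝ) ≤ 0 := ht.trans <| mul_nonpos_of_nonpos_of_nonneg
    (mul_nonpos_of_nonneg_of_nonpos (Nat.cast_nonneg _) (by simpa using hb)) (by positivity)
  rw [e.eq_of_cost_eq_zero (by exact_mod_cast h0.antisymm (Nat.cast_nonneg t))] at hs
  have := hs.2 ⟨∅, rfl, fun _ _ h => h.elim⟩
  simp [RAM.input, VCByGivenCVD.encode, encodeGraph] at this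

/-- Under SETH there is no constant `c < 1` such that all `q`-SAT problems can be solved in time
`2 ^ (c * n)`. -/
theorem SETH.false_of_qsatSolvable (hSETH : SETH) {c : ℝ} (hc0 : 0 ≤ c) (hc1 : c < 1)
    (hsolv : ∀ q, 0 < q → QSATSolvable q c) : False := by
  refine absurd (le_of_tendsto hSETH ?_) (not_le.2 hc1)
  filter_upwards [Filter.eventually_gt_atTop 0] with q hq
  exact csInf_le ⟨0, fun x hx => hx.1⟩ ⟨hc0, hsolv q hq⟩

/-- If for each of the block codes the graph instances can be solved in time `O*(b ^ k)` with
`b < 2`, then SETH fails. -/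
theorem SETH.false_of_graph (hSETH : SETH) {b : ℝ} (hb : b < 2) (given : Bool) (p : RAM.Prog)
    (C d : ℕ)
    (hp : ∀ (q β γ h : ℕ) (κ : BlockCode β γ h) (_ : 0 < q) (_ : 0 < β) (_ : h < γ) (φ : QSAT q),
      ∃ (t : ℕ) (s : RAM.State),
      RAM.Exec p (RAM.input (RAM.listOf (RAM.Expr.lengthE β γ q given) (RAM.Expr.entryE κ q)
        φ.encode)) t s ∧
      (t : ℝ) ≤ C * b ^ φ.elements β γ * (RAM.inputSize (RAM.listOf
        (RAM.Expr.lengthE β γ q given) (RAM.Expr.entryE κ q) φ.encode) : ℝ) ^ d ∧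
      (s.reg 0 = 1 ↔ φ.Satisfiable)) (hb0 : 0 < b) : False := by
  -- for `b < 1` the polynomial part of the running time would not be covered by `b ^ k`
  set b' := max b 1 with hb'
  have h1 : 1 ≤ b' := le_max_right _ _
  have hl0 : 0 ≤ Real.logb 2 b' := Real.logb_nonneg (by norm_num) h1
  have hl1 : Real.logb 2 b' < 1 := by
    rw [Real.logb_lt_iff_lt_rpow (by norm_num) (by linarith), Real.rpow_one]
    exact max_lt hb (by norm_num)
  obtain ⟨c₁, hc₁, hc₁'⟩ := exists_between hl1
  obtain ⟨c, hc, hc'⟩ := exists_between hc₁'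
  obtain ⟨β, γ, h, hβ, hγ, hch, hbγ⟩ := exists_block_sizes h1 hc₁
  obtain ⟨κ⟩ := BlockCode.nonempty hch
  refine hSETH.false_of_qsatSolvable (by linarith) hc' fun q hq =>
    qsatSolvable_of_graph κ h1 (by linarith) hc hbγ given p C d fun φ => ?_
  obtain ⟨t, s, e, ht, hs⟩ := hp q β γ h κ hq hβ hγ φ
  refine ⟨t, s, e, ht.trans ?_, hs⟩
  have : b ≤ b' := le_max_left _ _
  gcongr

theorem theorem5 (hSETH : SETH) (ε : ℝ) (hε : 0 < ε) :
    ¬ VCByCVDSolvable (2 - ε) ∧ ¬ VCByGivenCVDSolvable (2 - ε) := by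
  rcases le_or_gt (2 - ε) 0 with h0 | h0
  · exact ⟨not_vcByCVDSolvable_of_nonpos h0, not_vcByGivenCVDSolvable_of_nonpos h0⟩
  constructor
  · rintro ⟨p, C, d, hp⟩
    refine hSETH.false_of_graph (by linarith) false p C d (fun q β γ h κ hq hβ hγ φ => ?_) h0
    rw [RAM.Expr.listOf_lengthE_entryE κ q hβ (by omega), ← φ.hasVertexCover_iff κ hβ hq hγ]
    have := hp ⟨φ.vertices β γ, φ.graph κ hβ, φ.elements β γ, φ.coverSize β γ h,
      φ.modulator β γ, φ.card_modulator, φ.isCVD_modulator κ hβ⟩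
    simpa only [VCByCVD.encode, Bool.false_eq_true, if_false, List.append_nil] using this
  · rintro ⟨p, C, d, hp⟩
    refine hSETH.false_of_graph (by linarith) true p C d (fun q β γ h κ hq hβ hγ φ => ?_) h0
    rw [RAM.Expr.listOf_lengthE_entryE κ q hβ (by omega), ← φ.hasVertexCover_iff κ hβ hq hγ]
    have := hp ⟨φ.vertices β γ, φ.graph κ hβ, φ.elements β γ, φ.coverSize β γ h,
      φ.modulator β γ, φ.card_modulator, φ.isCVD_modulator κ hβ⟩
    simp only [VCByGivenCVD.encode] at this
    simpa only [if_true] using this
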